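/- Let $X=V(f)\subset\mathbb P^2$ be a reduced plane curve over $\mathbb R$. Write $X_{\mathrm{reg}}$, $X_{\mathrm{sing}}$ for its nonsingular and singular locus, $\mathbb R(X)$ for its ring of rational functions, and $\mathrm{Pic}(X)$ for the group of Cartier divisors on $X$ modulo linear equivalence. A class $\tau\in\mathrm{Pic}(X)$ with $2\tau=0$ is called \emph{definite} if $\tau=[D]$ for a divisor $D$ with support in $X_{\mathrm{reg}}$ such that $2D=\mathrm{div}(g)$ for some $g\in\mathbb R(X)^*$ with $g\ge0$ at all points of $X(\mathbb R)$ where $g$ is defined. A set $S\subset\mathbb P^2(\mathbb R)$ is called \emph{admissible} if $|S|=9$ and there is a reduced plane cubic $X$ over $\mathbb R$ with $S\subset X_{\mathrm{reg}}(\mathbb R)$ such that $$\sum_{P\in S}[P]=\tau+[\mathcal O_X(3)]\quad\text{in }\mathrm{Pic}(X)$$ for some nonzero definite class $\tau\in\mathrm{Pic}(X)$ with $2\tau=0$. \textbf{Proposition.} Let $S\subset\mathbb P^2(\mathbb R)$ be an admissible set, let $0\ne f\in\mathbb R[x_0,x_1,x_2]$ be a cubic form vanishing on $S$, and let $X=V(f)$.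 Let $I_3(S)$ denote the space of cubic forms in $\mathbb R[x_0,x_1,x_2]$ vanishing on $S$. (a) $I_3(S)=\mathbb R f$, so $X$ is uniquely determined by $S$. (b) $X$ is reduced, $S\subset X_{\mathrm{reg}}(\mathbb R)$, and $X(\mathbb R)$ is Zariski dense in $X$. (c) For every irreducible component $X'$ of $X$ (over $\mathbb R$), $|S\cap X'(\mathbb R)|=3d'$ where $d'=\deg(X')$. -/

import Mathlib

noncomputable section

/-- The real projective plane `ℙ²(ℝ)`. -/
abbrev RealPlane : Type := Projectivization ℝ (Fin 3 → ℝ)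

/-- The complex points `ℙ²(ℂ)` of the projective plane. -/
abbrev ComplexPlane : Type := Projectivization ℂ (Fin 3 → ℂ)

/-- The ring `ℝ[x₀, x₁, x₂]`. -/
abbrev TernaryPoly : Type := MvPolynomial (Fin 3) ℝ

/-- The space `I_d(S)` of ternary forms of degree `d` that vanish on `S`. -/
def formsThrough (d : ℕ) (S : Set RealPlane) : Submodule ℝ TernaryPoly where
  carrier := {h | h.IsHomogeneous d ∧ ∀ P ∈ S, MvPolynomial.eval P.rep h = 0}
  add_mem' := by
    rintro a b ⟨ha, ha'⟩ ⟨hb, hb'⟩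
    exact ⟨ha.add hb, fun P hP => by simp [ha' P hP, hb' P hP]⟩
  zero_mem' := ⟨MvPolynomial.isHomogeneous_zero _ _ _, fun _ _ => by simp⟩
  smul_mem' := by
    rintro c a ⟨ha, ha'⟩
    refine ⟨?_, fun P hP => by simp [MvPolynomial.smul_eval, ha' P hP]⟩
    exact (MvPolynomial.homogeneousSubmodule (Fin 3) ℝ d).smul_mem c ha

/-- A real point of the plane, regarded as a complex point. -/
def RealPlane.toComplex (P : RealPlane) : ComplexPlane :=
  Projectivization.mk ℂ (fun i => (P.rep i : ℂ)) (by
    intro h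
    apply P.rep_nonzero
    funext i
    simpa using congrFun h i)

/-! In the namespace `PlaneCurve`, `f` is a (squarefree) ternary form over `ℝ` and stands for the
projective plane curve `X = V(f)` over `ℝ`. The closed points of the `ℝ`-scheme `X` are the
complex points of `X` modulo complex conjugation; all notions below are defined with real forms,
hence are insensitive to conjugation. -/

namespace PlaneCurve

variable (f : TernaryPoly)

/-- `P` is a nonsingular real point of `X = V(f)`, i.e. `P ∈ X_reg(ℝ)`. -/
def IsRegularRealPoint (P : RealPlane) : Prop :=
  MvPolynomial.eval P.rep f = 0 ∧
    ∃ i : Fin 3, MvPolynomial.eval P.rep (MvPolynomial.pderiv i f) ≠ 0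

/-- The real points are Zariski dense in `X = V(f)`: a form that vanishes in all
real points of `X` vanishes on `X`. -/
def RealPointsDense : Prop :=
  ∀ (d : ℕ) (h : TernaryPoly), h.IsHomogeneous d →
    (∀ P : RealPlane, MvPolynomial.eval P.rep f = 0 → MvPolynomial.eval P.rep h = 0) →
    h ∈ (Ideal.span {f}).radical

/-- The set `X(ℂ)` of complex points of `X = V(f)`. -/
def complexPoints : Set ComplexPlane := {x | MvPolynomial.aeval x.rep f = 0}

/-- `x` is a singular point of `X`. -/
def IsSingular (x : complexPoints f) : Prop :=
  ∀ i : Fin 3, MvPolynomial.aeval x.1.rep (MvPolynomial.pderiv i f) = 0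

/-- The total ring of fractions of the homogeneous coordinate ring `ℝ[x₀, x₁, x₂]/(f)`. -/
abbrev TotalFractions : Type := FractionRing (TernaryPoly ⧸ Ideal.span {f})

/-- The natural map from `ℝ[x₀, x₁, x₂]` to the total ring of fractions. -/
def toFractions : TernaryPoly →+* TotalFractions f :=
  (algebraMap (TernaryPoly ⧸ Ideal.span {f}) (TotalFractions f)).comp
    (Ideal.Quotient.mk (Ideal.span {f}))

/-- `a = p / q` on `X`, where `p`, `q` are forms of the same degree and the denominator `q` is a
non-zero-divisor modulo `f` (it does not vanish on any component of `X`). -/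
def IsQuotient (a : TotalFractions f) (p q : TernaryPoly) : Prop :=
  (∃ n : ℕ, p.IsHomogeneous n ∧ q.IsHomogeneous n) ∧
    IsUnit (toFractions f q) ∧ a * toFractions f q = toFractions f p

/-- The group `ℝ(X)ˣ` of invertible rational functions on `X`. -/
def RationalUnits : Subgroup (TotalFractions f)ˣ where
  carrier := {u | ∃ p q : TernaryPoly, IsQuotient f u p q}
  mul_mem' := by
    rintro u v ⟨p, q, ⟨n, hp, hq⟩, hu, h⟩ ⟨p', q', ⟨n', hp', hq'⟩, hu', h'⟩
    refine ⟨p * p', q * q', ⟨n + n', hp.mul hp', hq.mul hq'⟩, ?_, ?_⟩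
    · rw [map_mul]; exact hu.mul hu'
    · rw [map_mul, map_mul, ← h, ← h', Units.val_mul]; ring
  one_mem' := ⟨1, 1, ⟨0, MvPolynomial.isHomogeneous_one _ _, MvPolynomial.isHomogeneous_one _ _⟩,
    by simp, by simp⟩
  inv_mem' := by
    rintro u ⟨p, q, ⟨n, hp, hq⟩, hu, h⟩
    refine ⟨q, p, ⟨n, hq, hp⟩, ?_, ?_⟩
    · rw [← h]; exact u.isUnit.mul hu
    · rw [← h, Units.inv_mul_cancel_left]

/-- The rational function `a` on `X` is regular at `x`. -/
def RegularAt (x : complexPoints f) (a : TotalFractions f) : Prop :=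
  ∃ p q : TernaryPoly, IsQuotient f a p q ∧ MvPolynomial.aeval x.1.rep q ≠ 0

/-- The rational function `a` on `X` is regular at `x` and vanishes there. -/
def VanishesAt (x : complexPoints f) (a : TotalFractions f) : Prop :=
  ∃ p q : TernaryPoly, IsQuotient f a p q ∧ MvPolynomial.aeval x.1.rep q ≠ 0 ∧
    MvPolynomial.aeval x.1.rep p = 0

/-- The rational functions on `X` that are invertible at `x`, i.e. are units of `𝒪_{X,x}`. -/
def UnitsAt (x : complexPoints f) : Subgroup (RationalUnits f) where
  carrier := {u | ∃ p q : TernaryPoly, IsQuotient f (u : (TotalFractions f)ˣ) p q ∧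
    MvPolynomial.aeval x.1.rep p ≠ 0 ∧ MvPolynomial.aeval x.1.rep q ≠ 0}
  mul_mem' := by
    rintro u v ⟨p, q, ⟨⟨n, hp, hq⟩, hu, h⟩, hpx, hqx⟩ ⟨p', q', ⟨⟨n', hp', hq'⟩, hu', h'⟩, hpx', hqx'⟩
    refine ⟨p * p', q * q', ⟨⟨n + n', hp.mul hp', hq.mul hq'⟩, ?_, ?_⟩, ?_, ?_⟩
    · rw [map_mul]; exact hu.mul hu'
    · rw [map_mul, map_mul, ← h, ← h', Subgroup.coe_mul, Units.val_mul]; ring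
    · rw [map_mul]; exact mul_ne_zero hpx hpx'
    · rw [map_mul]; exact mul_ne_zero hqx hqx'
  one_mem' := ⟨1, 1, ⟨⟨0, MvPolynomial.isHomogeneous_one _ _, MvPolynomial.isHomogeneous_one _ _⟩,
    by simp, by simp⟩, by simp, by simp⟩
  inv_mem' := by
    rintro u ⟨p, q, ⟨⟨n, hp, hq⟩, hu, h⟩, hpx, hqx⟩
    refine ⟨q, p, ⟨⟨n, hq, hp⟩, ?_, ?_⟩, hqx, hpx⟩
    · rw [← h]; exact (Units.isUnit _).mul hu
    · rw [← h, Subgroup.coe_inv, Units.inv_mul_cancel_left]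

/-- The stalk at `x` of the sheaf `𝒦ˣ/𝒪ˣ` on `X`: the group `ℝ(X)ˣ` modulo the rational functions
that are invertible at `x`. -/
def Germs (x : complexPoints f) : Type := RationalUnits f ⧸ UnitsAt f x

instance (x : complexPoints f) : CommGroup (Germs f x) :=
  inferInstanceAs (CommGroup (RationalUnits f ⧸ UnitsAt f x))

/-- The germ at `x` of the divisor of an invertible rational function. -/
def germ (x : complexPoints f) : RationalUnits f →* Germs f x := QuotientGroup.mk' (UnitsAt f x)

/-- The group `Div(X) = H⁰(X, 𝒦ˣ/𝒪ˣ)` of Cartier divisors on `X`, written multiplicatively: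
families of germs that on a neighbourhood `{h ≠ 0}` of each point are given by one rational
function. -/
def CartierDivisors : Subgroup (∀ x : complexPoints f, Germs f x) where
  carrier := {D | ∀ x : complexPoints f, ∃ (h : TernaryPoly) (g : RationalUnits f),
    (∃ n : ℕ, h.IsHomogeneous n) ∧ MvPolynomial.aeval x.1.rep h ≠ 0 ∧
      ∀ y : complexPoints f, MvPolynomial.aeval y.1.rep h ≠ 0 →
        D y = germ f y g}
  mul_mem' := by
    intro D E hD hE x
    obtain ⟨h, g, ⟨n, hn⟩, hx, H⟩ := hD x
    obtain ⟨h', g', ⟨n', hn'⟩, hx', H'⟩ := hE x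
    refine ⟨h * h', g * g', ⟨n + n', hn.mul hn'⟩, ?_, fun y hy => ?_⟩
    · rw [map_mul]; exact mul_ne_zero hx hx'
    · rw [map_mul] at hy
      rw [Pi.mul_apply, H y (left_ne_zero_of_mul hy), H' y (right_ne_zero_of_mul hy), map_mul]
  one_mem' := fun x => ⟨1, 1, ⟨0, MvPolynomial.isHomogeneous_one _ _⟩, by simp, fun _ _ => (map_one _).symm⟩
  inv_mem' := by
    intro D hD x
    obtain ⟨h, g, hn, hx, H⟩ := hD x
    refine ⟨h, g⁻¹, hn, hx, fun y hy => ?_⟩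
    rw [Pi.inv_apply, H y hy, map_inv]

/-- The principal divisor `div(g)` of an invertible rational function `g`. -/
def principal : RationalUnits f →* CartierDivisors f where
  toFun g := ⟨fun x => germ f x g,
    fun x => ⟨1, g, ⟨0, MvPolynomial.isHomogeneous_one _ _⟩, by simp, fun _ _ => rfl⟩⟩
  map_one' := Subtype.ext (funext fun x => map_one (germ f x))
  map_mul' g h := Subtype.ext (funext fun x => map_mul (germ f x) g h)

/-- The Picard group `Pic(X)`: Cartier divisors modulo linear equivalence, written
multiplicatively. -/
def Pic : Type := CartierDivisors f ⧸ (principal f).range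

instance : CommGroup (Pic f) :=
  inferInstanceAs (CommGroup (CartierDivisors f ⧸ (principal f).range))

/-- The divisor class of a Cartier divisor. -/
def divisorClass : CartierDivisors f →* Pic f := QuotientGroup.mk' (principal f).range

/-- `D` is the divisor on `X` of some form `s` of degree `n` that vanishes on no component of
`X`: at each point `x` a local equation is `s / m`, with `m` a form of degree `n` not vanishing
at `x`. The class of such a `D` is `[𝒪_X(n)]`. -/
def IsDivisorOfForm (n : ℕ) (D : CartierDivisors f) : Prop :=
  ∃ s : TernaryPoly, s.IsHomogeneous n ∧ IsUnit (toFractions f s) ∧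
    ∀ x : complexPoints f, ∃ (m : TernaryPoly) (g : RationalUnits f),
      m.IsHomogeneous n ∧ MvPolynomial.aeval x.1.rep m ≠ 0 ∧
        IsQuotient f (g : (TotalFractions f)ˣ) s m ∧ D.1 x = germ f x g

/-- `c = [𝒪_X(n)]` in `Pic(X)`. -/
def IsTwistClass (n : ℕ) (c : Pic f) : Prop :=
  ∃ D : CartierDivisors f, IsDivisorOfForm f n D ∧ divisorClass f D = c

/-- `t` generates the maximal ideal of the local ring of `X` at `x`. -/
def IsUniformizer (x : complexPoints f) (t : RationalUnits f) : Prop :=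
  ∀ a : TotalFractions f,
    VanishesAt f x a ↔ ∃ b : TotalFractions f, RegularAt f x b ∧
      a = ((t : (TotalFractions f)ˣ) : TotalFractions f) * b

/-- `D` is the Cartier divisor of the Weil divisor `∑_{P ∈ S} P`, for a set `S` of nonsingular
real points of `X`: a local equation is a uniformizer at the points of `S`, and `1` elsewhere. -/
def IsSumOfPoints (S : Set RealPlane) (D : CartierDivisors f) : Prop :=
  ∀ x : complexPoints f,
    (x.1 ∈ RealPlane.toComplex '' S →
      ∃ t : RationalUnits f, IsUniformizer f x t ∧ D.1 x = germ f x t) ∧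
    (x.1 ∉ RealPlane.toComplex '' S → D.1 x = 1)

/-- `c = ∑_{P ∈ S} [P]` in `Pic(X)`. -/
def IsClassOfPoints (S : Set RealPlane) (c : Pic f) : Prop :=
  ∃ D : CartierDivisors f, IsSumOfPoints f S D ∧ divisorClass f D = c

/-- `g ≥ 0` at all real points of `X` where `g` is defined. (If `g = p / q` with `p`, `q` forms of
the same degree, then `p q` has even degree and the sign of `g` where `q ≠ 0`.) -/
def NonnegOnReal (g : RationalUnits f) : Prop :=
  ∀ p q : TernaryPoly, IsQuotient f (g : (TotalFractions f)ˣ) p q →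
    ∀ P : RealPlane, MvPolynomial.eval P.rep f = 0 →
      0 ≤ MvPolynomial.eval P.rep p * MvPolynomial.eval P.rep q

/-- A class `τ` with `2τ = 0` is definite if it is represented by a divisor `D` with nonsingular
support such that `2D = div(g)` for some `g ∈ ℝ(X)ˣ` with `g ≥ 0` on `X(ℝ)`. -/
def IsDefinite (τ : Pic f) : Prop :=
  ∃ D : CartierDivisors f, divisorClass f D = τ ∧
    (∀ x : complexPoints f, IsSingular f x → D.1 x = 1) ∧
    ∃ g : RationalUnits f, D ^ 2 = principal f g ∧ NonnegOnReal f g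

/-- `c = τ_X`, i.e. `c = τ + [𝒪_X(3)]` where `τ` is a nonzero definite 2-torsion class. -/
def IsTau (c : Pic f) : Prop :=
  ∃ τ o : Pic f, τ ≠ 1 ∧ τ ^ 2 = 1 ∧ IsDefinite f τ ∧ IsTwistClass f 3 o ∧ c = τ * o

end PlaneCurve

/-- `S ⊂ ℙ²(ℝ)` is admissible: `|S| = 9`, and there is a reduced plane cubic `X = V(f)` with
`S ⊂ X_reg(ℝ)` and `∑_{P ∈ S} [P] = τ_X` in `Pic(X)`. -/
def IsAdmissible (S : Set RealPlane) : Prop :=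
  S.ncard = 9 ∧ ∃ f : TernaryPoly, f.IsHomogeneous 3 ∧ Squarefree f ∧
    (∀ P ∈ S, PlaneCurve.IsRegularRealPoint f P) ∧
    ∃ c : PlaneCurve.Pic f, PlaneCurve.IsClassOfPoints f S c ∧ PlaneCurve.IsTau f c

end

/-!
The divisor class of the nine points satisfies `∑_{P ∈ S} [P] = τ + [𝒪_X(3)]` with `2 τ = 0` and
`τ ≠ 0`.

*Degrees on components.* Since `2 τ = 0`, there is a rational function `h / q` of degree `6` (with
`h`, `q` forms) whose divisor on `X` is `2 ∑_{P ∈ S} P`. Let `f₁` be a factor of degree `d₁` of the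
equation of `X`. In large degrees `N`, multiplication by `h / q` embeds the forms of degree `N`
modulo `f₁` into the forms of degree `N + 6` modulo `f₁`, and all forms in the image vanish to
second order along the curve `f₁ = 0` in the points of `S` that lie on it. These conditions are
linearly independent for large `N`, and the codimension of the image is `6 d₁` by the Hilbert
function of a plane curve. So at most `3 d₁` points of `S` are on `f₁ = 0` (`two_mul_card_le`,
`card_filter_le`). Every point of `S` lies on `f₁ = 0` or on the complementary curve of degree
`3 - d₁`, and `|S| = 9`, so equality holds (`card_filter_eq`). No theory of intersection
multiplicities is needed.

*Uniqueness of the cubic.* Let `g` be another cubic through `S`. Without the greatest common divisor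
of the two cubics there remain coprime forms of some degree `j`, both vanishing in `3 j` points of
`S`. Bézout's theorem gives `3 j ≤ j ^ 2`, so `j = 0`, in which case the cubics are proportional, or
`j = 3`. In the second case the two cubics meet in nine points, hence transversally and nowhere else:
forms of large degree through `S` lie in the ideal of the two cubics
(`exists_eq_add_of_card_eq_mul`). Then `∑_{P ∈ S} P` is the divisor of the cubic form `g`, and
`τ = 0`, a contradiction (`class_eq_of_isRelPrime`).

*Density.* Every component contains a point of `S`, a nonsingular real point, and by a change of sign
there are infinitely many real points near it (`infinite_zeros`). By Bézout's theorem a form that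
vanishes in all real points is divisible by the equation of every component
(`realPointsDense_of_forall_factor`).
-/

noncomputable section

namespace TernaryForm

open MvPolynomial

/-! ### Homogeneous polynomials -/

/-- The polynomial `p (t x)`, as a polynomial in `t`: its coefficients are the homogeneous
components of `p`. -/
def scaling (p : TernaryPoly) : Polynomial TernaryPoly :=
  aeval (fun i => Polynomial.X * Polynomial.C (X i)) p

lemma scaling_of_isHomogeneous {p : TernaryPoly} {n : ℕ} (hp : p.IsHomogeneous n) :
    scaling p = Polynomial.C p * Polynomial.X ^ n := by
  conv_lhs => rw [p.as_sum]
  conv_rhs => rw [p.as_sum]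
  rw [scaling, map_sum, map_sum, Finset.sum_mul]
  refine Finset.sum_congr rfl fun d hd => ?_
  have hdeg : d.sum (fun _ k => k) = n := by
    have := hp (mem_support_iff.1 hd)
    simpa [Finsupp.weight_apply] using this
  have h1 : (monomial d (coeff d p) : TernaryPoly) = C (coeff d p) * d.prod fun i k => X i ^ k :=
    monomial_eq
  rw [aeval_monomial, h1, map_mul, ← hdeg]
  simp only [Finsupp.prod, Finsupp.sum, mul_pow, Finset.prod_mul_distrib, Finset.prod_pow_eq_pow_sum,
    map_prod, map_pow]
  rw [IsScalarTower.algebraMap_apply ℝ TernaryPoly (Polynomial TernaryPoly)]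
  simp only [Polynomial.algebraMap_eq, algebraMap_eq]
  ring

lemma coeff_scaling (p : TernaryPoly) (k : ℕ) :
    (scaling p).coeff k = homogeneousComponent k p := by
  conv_lhs => rw [← sum_homogeneousComponent p]
  have h : scaling (∑ i ∈ Finset.range (p.totalDegree + 1), homogeneousComponent i p) =
      ∑ i ∈ Finset.range (p.totalDegree + 1),
        Polynomial.C (homogeneousComponent i p) * Polynomial.X ^ i := by
    rw [scaling, map_sum]
    exact Finset.sum_congr rfl fun i _ =>
      scaling_of_isHomogeneous (homogeneousComponent_isHomogeneous i p)
  rw [h]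
  simp only [Polynomial.finsetSum_coeff, Polynomial.coeff_C_mul, Polynomial.coeff_X_pow]
  simp only [mul_ite, mul_one, mul_zero, Finset.sum_ite_eq, Finset.mem_range]
  split_ifs with hk
  · rfl
  · exact (homogeneousComponent_eq_zero _ _ (by omega)).symm

/-- The factors of a nonzero form are forms: for `t ↦ a (t x)` and `t ↦ b (t x)` both the degrees
and the trailing degrees add up to the degree of the product. -/
lemma isHomogeneous_factors {a b : TernaryPoly} {n : ℕ} (h : (a * b).IsHomogeneous n)
    (h0 : a * b ≠ 0) : ∃ i j, i + j = n ∧ a.IsHomogeneous i ∧ b.IsHomogeneous j := by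
  have hs : scaling a * scaling b = Polynomial.C (a * b) * Polynomial.X ^ n := by
    rw [← scaling_of_isHomogeneous h, scaling, scaling, scaling, map_mul]
  have hne : scaling a * scaling b ≠ 0 := by
    rw [hs]; exact mul_ne_zero (by simpa using h0) (pow_ne_zero _ Polynomial.X_ne_zero)
  have ha := left_ne_zero_of_mul hne
  have hb := right_ne_zero_of_mul hne
  have h1 : (scaling a).natDegree + (scaling b).natDegree = n := by
    rw [← Polynomial.natDegree_mul ha hb, hs, Polynomial.natDegree_C_mul_X_pow _ _ h0]
  have h2 : (scaling a).natTrailingDegree + (scaling b).natTrailingDegree = n := by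
    rw [← Polynomial.natTrailingDegree_mul ha hb, hs, Polynomial.C_mul_X_pow_eq_monomial,
      Polynomial.natTrailingDegree_monomial h0]
  have h3 := (scaling a).natTrailingDegree_le_natDegree
  have h4 := (scaling b).natTrailingDegree_le_natDegree
  have key : ∀ p : TernaryPoly, (scaling p).natTrailingDegree = (scaling p).natDegree →
      p.IsHomogeneous (scaling p).natDegree := by
    intro p hp
    rw [← sum_homogeneousComponent p]
    refine IsHomogeneous.sum _ _ _ fun k _ => ?_
    by_cases hk : homogeneousComponent k p = 0
    · rw [hk]; exact isHomogeneous_zero _ _ _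
    · rw [sum_homogeneousComponent]
      have hk' : (scaling p).coeff k ≠ 0 := by rwa [coeff_scaling]
      have := Polynomial.le_natDegree_of_ne_zero hk'
      have := Polynomial.natTrailingDegree_le_of_ne_zero hk'
      obtain rfl : k = (scaling p).natDegree := by omega
      exact homogeneousComponent_isHomogeneous _ _
  exact ⟨_, _, h1, key a (by omega), key b (by omega)⟩

lemma isHomogeneous_of_mul {a b : TernaryPoly} {d n : ℕ} (ha : a.IsHomogeneous d) (ha0 : a ≠ 0)
    (h : (a * b).IsHomogeneous (d + n)) : b.IsHomogeneous n := by
  by_cases hb : b = 0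
  · rw [hb]; exact isHomogeneous_zero _ _ _
  obtain ⟨i, j, hij, hi, hj⟩ := isHomogeneous_factors h (mul_ne_zero ha0 hb)
  have := hi.inj_right ha ha0
  obtain rfl : j = n := by omega
  exact hj

lemma homogeneousComponent_mul {a b : TernaryPoly} {d n : ℕ} (ha : a.IsHomogeneous d) :
    homogeneousComponent (d + n) (a * b) = a * homogeneousComponent n b := by
  rw [← coeff_scaling, ← coeff_scaling]
  have : scaling (a * b) = Polynomial.C a * (scaling b) * Polynomial.X ^ d := by
    rw [scaling, map_mul, ← scaling, ← scaling, scaling_of_isHomogeneous ha]; ring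
  rw [this, add_comm, Polynomial.coeff_mul_X_pow, Polynomial.coeff_C_mul]

/-- The space of ternary forms of degree `n`. -/
abbrev forms (n : ℕ) : Submodule ℝ TernaryPoly := homogeneousSubmodule (Fin 3) ℝ n

instance (n : ℕ) : FiniteDimensional ℝ (forms n) :=
  Module.Finite.iff_fg.2 (homogeneousSubmodule_fg _ _ n)

lemma two_mul_finrank_forms (n : ℕ) :
    2 * Module.finrank ℝ (forms n) = (n + 1) * (n + 2) := by
  have hset : {d : Fin 3 →₀ ℕ | d.degree = n} =
      ((Finset.univ : Finset (Fin 3)).finsuppAntidiag n : Set (Fin 3 →₀ ℕ)) := by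
    ext d
    simp [Finset.mem_finsuppAntidiag, Finsupp.degree_eq_sum]
  have h : Module.finrank ℝ (forms n) = (n + 2).choose 2 := by
    rw [forms, homogeneousSubmodule_eq_finsupp_supported, hset,
      (AddMonoidAlgebra.supportedEquivFinsupp (R := ℝ) (S := ℝ) _).finrank_eq, Module.finrank_finsupp_self]
    simp only [Finset.coe_sort_coe, Fintype.card_coe]
    rw [Finset.card_finsuppAntidiag_nat_eq_choose]
    simpa [add_comm 3 n] using Nat.choose_symm_add (a := n) (b := 2)
  rw [h, Nat.choose_two_right, Nat.mul_div_cancel']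
  · exact mul_comm _ _
  · exact (Nat.even_mul_pred_self _).two_dvd

/-- Multiples of `a` by the members of `U`. -/
def multiples (a : TernaryPoly) (U : Submodule ℝ TernaryPoly) : Submodule ℝ TernaryPoly :=
  U.map (LinearMap.mulLeft ℝ a)

lemma mem_multiples {a x : TernaryPoly} {U : Submodule ℝ TernaryPoly} :
    x ∈ multiples a U ↔ ∃ u ∈ U, a * u = x := Iff.rfl

lemma finrank_multiples {a : TernaryPoly} (ha : a ≠ 0) (U : Submodule ℝ TernaryPoly) :
    Module.finrank ℝ (multiples a U) = Module.finrank ℝ U :=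
  (U.equivMapOfInjective (LinearMap.mulLeft ℝ a) fun _ _ h => mul_left_cancel₀ ha h).finrank_eq.symm

instance (a : TernaryPoly) (U : Submodule ℝ TernaryPoly) [FiniteDimensional ℝ U] :
    FiniteDimensional ℝ (multiples a U) :=
  inferInstanceAs (FiniteDimensional ℝ (U.map (LinearMap.mulLeft ℝ a)))

/-- `(f, g)` is a regular sequence: the syzygies of `f` and `g` are the trivial ones. This gives
Bézout's theorem in the form of a bound for the codimension of the ideal `(f, g)` in degree
`N + d + e`. -/
lemma finrank_forms_le_finrank_sup_add_mul {f g : TernaryPoly} {d e : ℕ} (hf : f.IsHomogeneous d)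
    (hf0 : f ≠ 0) (hg0 : g ≠ 0)
    (hfg : ∀ a, f ∣ g * a → f ∣ a) (N : ℕ) :
    Module.finrank ℝ (forms (N + d + e)) ≤
      Module.finrank ℝ ↥(multiples f (forms (N + e)) ⊔ multiples g (forms (N + d))) + d * e := by
  have h := Submodule.finrank_sup_add_finrank_inf_eq (multiples f (forms (N + e)))
    (multiples g (forms (N + d)))
  have hle : multiples f (forms (N + e)) ⊓ multiples g (forms (N + d)) ≤
      multiples (f * g) (forms N) := by
    rintro x ⟨⟨u, hu, rfl⟩, ⟨v, hv, hx⟩⟩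
    simp only [LinearMap.mulLeft_apply] at hx ⊢
    obtain ⟨b, rfl⟩ := hfg v ⟨u, hx⟩
    exact ⟨b, isHomogeneous_of_mul hf hf0 (by rwa [add_comm d N]), by
      simp only [LinearMap.mulLeft_apply]; rw [← hx]; ring⟩
  have h1 := Submodule.finrank_mono hle
  rw [finrank_multiples (mul_ne_zero hf0 hg0)] at h1
  rw [finrank_multiples hf0, finrank_multiples hg0] at h
  have e1 := two_mul_finrank_forms N
  have e2 := two_mul_finrank_forms (N + e)
  have e3 := two_mul_finrank_forms (N + d)
  have e4 := two_mul_finrank_forms (N + d + e)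
  nlinarith

/-! ### Interpolation by forms -/

lemma eq_of_rep_eq_smul {P Q : RealPlane} {c : ℝ} (h : P.rep = c • Q.rep) : P = Q := by
  rw [← P.mk_rep, ← Q.mk_rep, Projectivization.mk_eq_mk_iff']
  exact ⟨c, h.symm⟩

/-- A real linear form through the real point `y` that misses the point `x`, which may be real or
complex. -/
lemma exists_linearForm {K : Type*} [Field K] [Algebra ℝ K] {y : Fin 3 → ℝ} (hy : y ≠ 0)
    {x : Fin 3 → K} (hx : ∀ c : K, x ≠ fun i => c * algebraMap ℝ K (y i)) :
    ∃ l : TernaryPoly, l.IsHomogeneous 1 ∧ eval y l = 0 ∧ aeval x l ≠ 0 := by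
  obtain ⟨j, hj⟩ := Function.ne_iff.1 hy
  have hj' : algebraMap ℝ K (y j) ≠ 0 := by simpa using hj
  by_contra! H
  refine hx (x j / algebraMap ℝ K (y j)) (funext fun i => ?_)
  have := H (C (y j) * X i - C (y i) * X j)
    ((isHomogeneous_C_mul_X _ _).sub (isHomogeneous_C_mul_X _ _)) (by simp; ring)
  simp only [map_sub, map_mul, aeval_C, aeval_X] at this
  field_simp
  linear_combination this

/-- The derivative at `x` in the direction `v`. -/
def dirDeriv (x v : Fin 3 → ℝ) : TernaryPoly →ₗ[ℝ] ℝ where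
  toFun h := ∑ i, v i * eval x (pderiv i h)
  map_add' a b := by simp [mul_add, Finset.sum_add_distrib]
  map_smul' r a := by
    simp only [Derivation.map_smul, smul_eval, RingHom.id_apply, smul_eq_mul, Finset.mul_sum]
    exact Finset.sum_congr rfl fun i _ => by ring

lemma dirDeriv_mul (x v : Fin 3 → ℝ) (a b : TernaryPoly) :
    dirDeriv x v (a * b) = dirDeriv x v a * eval x b + eval x a * dirDeriv x v b := by
  simp only [dirDeriv, LinearMap.coe_mk, AddHom.coe_mk, Derivation.leibniz, smul_eq_mul, map_add,
    map_mul, Finset.sum_mul, Finset.mul_sum, ← Finset.sum_add_distrib]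
  exact Finset.sum_congr rfl fun i _ => by ring

lemma dirDeriv_linearForm (x v : Fin 3 → ℝ) {l : TernaryPoly} (hl : l.IsHomogeneous 1) :
    dirDeriv x v l = eval v l := by
  have h : l ∈ Submodule.span ℝ (Set.range (X : Fin 3 → TernaryPoly)) := by
    rw [← homogeneousSubmodule_one_eq_span_X]; exact hl
  induction h using Submodule.span_induction with
  | mem p hp =>
    obtain ⟨j, rfl⟩ := hp
    simp [dirDeriv, pderiv_X, Pi.single_apply, apply_ite]
  | zero => simp
  | add a b ha hb iha ihb =>
    rw [homogeneousSubmodule_one_eq_span_X.symm] at ha hb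
    rw [map_add, map_add, iha ha, ihb hb]
  | smul r a ha iha =>
    rw [homogeneousSubmodule_one_eq_span_X.symm] at ha
    rw [map_smul, smul_eval, iha ha, smul_eq_mul]

lemma exists_linearForm_eval_eq {x v : Fin 3 → ℝ} (hx : x ≠ 0) (hv : ∀ c : ℝ, v ≠ c • x)
    (a b : ℝ) : ∃ l : TernaryPoly, l.IsHomogeneous 1 ∧ eval x l = a ∧ eval v l = b := by
  obtain ⟨l, hl, hlx, hlv⟩ := exists_linearForm (K := ℝ) hx (x := v) fun c h => hv c h
  have hv0 : v ≠ 0 := fun h => hv 0 (by simpa using h)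
  obtain ⟨m, hm, hmv, hmx⟩ := exists_linearForm (K := ℝ) hv0 (x := x) fun c h => by
    have hc : c ≠ 0 := by rintro rfl; exact hx (by funext i; simp [h])
    refine hv c⁻¹ (funext fun i => ?_)
    have := congrFun h i
    simp only [Algebra.algebraMap_self, RingHom.id_apply] at this
    simp [this, hc]
  simp only [aeval_eq_eval] at hlv hmx
  refine ⟨C (a / eval x m) * m + C (b / eval v l) * l, (hm.C_mul _).add (hl.C_mul _), ?_, ?_⟩
  · simp [hlx, div_mul_cancel₀ _ (show eval x m ≠ 0 from hmx)]
  · simp [hmv, div_mul_cancel₀ _ (show eval v l ≠ 0 from hlv)]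

/-- Values and tangential derivatives at finitely many points can be prescribed in every
sufficiently large degree. -/
lemma exists_form_jet (S : Finset RealPlane) {v : RealPlane → Fin 3 → ℝ}
    (hv : ∀ P : RealPlane, ∀ c : ℝ, v P ≠ c • P.rep) {n : ℕ} (hn : 2 * S.card ≤ n)
    (w : S → ℝ × ℝ) : ∃ u ∈ forms n, ∀ P : S,
      eval P.1.rep u = (w P).1 ∧ dirDeriv P.1.rep (v P) u = (w P).2 := by
  classical
  suffices H : ∀ P : S, ∃ u ∈ forms n,
      (eval P.1.rep u = (w P).1 ∧ dirDeriv P.1.rep (v P) u = (w P).2) ∧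
      ∀ Q : S, Q ≠ P → eval Q.1.rep u = 0 ∧ dirDeriv Q.1.rep (v Q) u = 0 by
    choose u hu h1 h2 using H
    refine ⟨∑ P, u P, Submodule.sum_mem _ fun P _ => hu P, fun Q => ⟨?_, ?_⟩⟩
    · rw [map_sum, Finset.sum_eq_single Q (fun P _ h => (h2 P Q h.symm).1) (by simp), (h1 Q).1]
    · rw [map_sum, Finset.sum_eq_single Q (fun P _ h => (h2 P Q h.symm).2) (by simp), (h1 Q).2]
  intro P
  have hl : ∀ Q : RealPlane, ∃ l : TernaryPoly, l.IsHomogeneous 1 ∧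
      (Q ≠ P → eval Q.rep l = 0) ∧ eval P.1.rep l ≠ 0 := by
    intro Q
    by_cases hQ : Q = P
    · obtain ⟨l, h1, h2, -⟩ := exists_linearForm_eval_eq P.1.rep_nonzero (hv P) 1 0
      exact ⟨l, h1, fun h => absurd hQ h, by rw [h2]; exact one_ne_zero⟩
    · obtain ⟨l, h1, h2, h3⟩ := exists_linearForm (K := ℝ) Q.rep_nonzero (x := P.1.rep)
        fun c h => hQ (eq_of_rep_eq_smul (c := c) h).symm
      exact ⟨l, h1, fun _ => h2, by simpa [aeval_eq_eval] using h3⟩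
  choose l hl1 hl2 hl3 using hl
  -- The form `b` vanishes doubly in all points of `S` except `P`, and not in `P`.
  obtain ⟨k, hk⟩ : ∃ k, n = 2 * (S.erase P.1).card + k + 1 := by
    have := Finset.card_erase_add_one P.2
    exact ⟨n - (2 * (S.erase P.1).card + 1), by omega⟩
  set b : TernaryPoly := (∏ Q ∈ S.erase P.1, l Q) ^ 2 * l P ^ k with hb
  have hbhom : b.IsHomogeneous (2 * (S.erase P.1).card + k) := by
    have h1 := (IsHomogeneous.prod (S.erase P.1) l (fun _ => 1) fun Q _ => hl1 Q).pow 2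
    have h2 := h1.mul ((hl1 P.1).pow k)
    convert! h2 using 1
    simp; ring
  have hbP : eval P.1.rep b ≠ 0 := by
    rw [hb, map_mul, map_pow, map_pow, map_prod]
    exact mul_ne_zero (pow_ne_zero _ (Finset.prod_ne_zero_iff.2 fun Q _ => hl3 Q))
      (pow_ne_zero _ (hl3 _))
  obtain ⟨m, hm, hmP, hmv⟩ := exists_linearForm_eval_eq P.1.rep_nonzero (hv P)
    ((w P).1 / eval P.1.rep b)
    (((w P).2 - dirDeriv P.1.rep (v P) b * ((w P).1 / eval P.1.rep b)) / eval P.1.rep b)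
  refine ⟨b * m, hk ▸ hbhom.mul hm, ⟨?_, ?_⟩, fun Q hQ => ?_⟩
  · rw [map_mul, hmP, mul_div_cancel₀ _ hbP]
  · rw [dirDeriv_mul, dirDeriv_linearForm _ _ hm, hmv, hmP, mul_div_cancel₀ _ hbP]
    ring
  · have hQP : Q.1 ≠ P.1 := fun h => hQ (Subtype.ext h)
    obtain ⟨r, hr⟩ : l Q.1 ∣ ∏ Q ∈ S.erase P.1, l Q :=
      Finset.dvd_prod_of_mem _ (Finset.mem_erase.2 ⟨hQP, Q.2⟩)
    have h0 := hl2 Q hQP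
    have : b * m = l Q * (l Q * (r ^ 2 * l P ^ k * m)) := by rw [hb, hr]; ring
    rw [this]
    simp [dirDeriv_mul, h0]

lemma finrank_inf_ker {V W : Type*} [AddCommGroup V] [Module ℝ V] [AddCommGroup W] [Module ℝ W]
    (U : Submodule ℝ V) [FiniteDimensional ℝ U] (φ : V →ₗ[ℝ] W) (h : ∀ w, ∃ u ∈ U, φ u = w) :
    Module.finrank ℝ ↥(U ⊓ LinearMap.ker φ) + Module.finrank ℝ W = Module.finrank ℝ U := by
  have h1 := LinearMap.finrank_range_add_finrank_ker (φ.domRestrict U)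
  have h2 : LinearMap.range (φ.domRestrict U) = ⊤ :=
    LinearMap.range_eq_top.2 fun w => by
      obtain ⟨u, hu, rfl⟩ := h w
      exact ⟨⟨u, hu⟩, rfl⟩
  have h3 : LinearMap.ker (φ.domRestrict U) = (LinearMap.ker φ).comap U.subtype := rfl
  rw [h2, finrank_top, h3, ← Submodule.finrank_map_subtype_eq, Submodule.map_comap_subtype] at h1
  rw [← h1, add_comm]

/-- The value and the derivative in direction `v P`, for all points `P` of `S`. -/
def jets (S : Finset RealPlane) (v : RealPlane → Fin 3 → ℝ) : TernaryPoly →ₗ[ℝ] (S → ℝ × ℝ) :=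
  LinearMap.pi fun P => (aeval P.1.rep).toLinearMap.prod (dirDeriv P.1.rep (v P))

lemma mem_ker_jets {S : Finset RealPlane} {v : RealPlane → Fin 3 → ℝ} {u : TernaryPoly} :
    u ∈ LinearMap.ker (jets S v) ↔
      ∀ P ∈ S, eval P.rep u = 0 ∧ dirDeriv P.rep (v P) u = 0 := by
  rw [LinearMap.mem_ker, funext_iff]
  simp [jets]

lemma finrank_inf_ker_jets (S : Finset RealPlane) {v : RealPlane → Fin 3 → ℝ}
    (hv : ∀ P : RealPlane, ∀ c : ℝ, v P ≠ c • P.rep) {n : ℕ} (hn : 2 * S.card ≤ n) :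
    Module.finrank ℝ ↥(forms n ⊓ LinearMap.ker (jets S v)) + 2 * S.card =
      Module.finrank ℝ (forms n) := by
  rw [← finrank_inf_ker (forms n) (jets S v)]
  · simp [Module.finrank_pi_fintype, mul_comm]
  · intro w
    obtain ⟨u, hu, h⟩ := exists_form_jet S hv hn w
    exact ⟨u, hu, funext fun P => by simp [jets, h P]⟩

/-- In every plane of vectors killed by a linear functional there is one that is not a multiple of
a given vector. -/
lemma exists_tangent (x : Fin 3 → ℝ) (φ : (Fin 3 → ℝ) →ₗ[ℝ] ℝ) :
    ∃ v, φ v = 0 ∧ ∀ c : ℝ, v ≠ c • x := by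
  by_contra! H
  have hle : LinearMap.ker φ ≤ Submodule.span ℝ {x} := fun v hv => by
    obtain ⟨c, hc⟩ := H v hv
    exact Submodule.mem_span_singleton.2 ⟨c, hc.symm⟩
  have h1 := Submodule.finrank_mono hle
  have h2 : Module.finrank ℝ (Submodule.span ℝ {x}) ≤ 1 := by
    simpa using finrank_span_le_card (R := ℝ) ({x} : Set (Fin 3 → ℝ))
  have h3 := LinearMap.finrank_range_add_finrank_ker φ
  have h4 := Submodule.finrank_le (LinearMap.range φ)
  rw [Module.finrank_fin_fun] at h3
  rw [Module.finrank_self] at h4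
  omega

lemma exists_tangent_dirDeriv (f : TernaryPoly) :
    ∃ v : RealPlane → Fin 3 → ℝ, (∀ P : RealPlane, dirDeriv P.rep (v P) f = 0) ∧
      ∀ P : RealPlane, ∀ c : ℝ, v P ≠ c • P.rep := by
  have H : ∀ P : RealPlane, ∃ v : Fin 3 → ℝ, dirDeriv P.rep v f = 0 ∧ ∀ c : ℝ, v ≠ c • P.rep :=
    fun P => by
      obtain ⟨v, hv, hv'⟩ := exists_tangent P.rep
        (∑ i, (eval P.rep (pderiv i f)) • LinearMap.proj (R := ℝ) (φ := fun _ : Fin 3 => ℝ) i)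
      refine ⟨v, ?_, hv'⟩
      simpa [dirDeriv, mul_comm] using hv
  choose v h1 h2 using H
  exact ⟨v, h1, h2⟩

instance (n : ℕ) (S : Set RealPlane) : FiniteDimensional ℝ (formsThrough n S) :=
  Submodule.finiteDimensional_of_le (show formsThrough n S ≤ forms n from fun _ h => h.1)

lemma finrank_formsThrough (S : Finset RealPlane) {n : ℕ} (hn : 2 * S.card ≤ n) :
    Module.finrank ℝ (formsThrough n S) + S.card = Module.finrank ℝ (forms n) := by
  obtain ⟨v, -, hv⟩ := exists_tangent_dirDeriv 0
  have h := finrank_inf_ker (forms n)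
    (LinearMap.pi fun P : S => (aeval (R := ℝ) P.1.rep).toLinearMap) (fun w => by
      obtain ⟨u, hu, h⟩ := exists_form_jet S hv hn fun P => (w P, 0)
      exact ⟨u, hu, funext fun P => by simp [h P]⟩)
  have e : forms n ⊓ LinearMap.ker
      (LinearMap.pi fun P : S => (aeval (R := ℝ) P.1.rep).toLinearMap) = formsThrough n S := by
    ext u
    simp only [Submodule.mem_inf, LinearMap.mem_ker, funext_iff, formsThrough]
    simp
  rw [e] at h
  simpa using h

/-! ### Bézout's theorem -/

lemma sup_multiples_le_formsThrough {f g : TernaryPoly} {d e : ℕ} (hf : f.IsHomogeneous d)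
    (hg : g.IsHomogeneous e) {S : Set RealPlane} (hfS : ∀ P ∈ S, eval P.rep f = 0)
    (hgS : ∀ P ∈ S, eval P.rep g = 0) (N : ℕ) :
    multiples f (forms (N + e)) ⊔ multiples g (forms (N + d)) ≤ formsThrough (N + d + e) S := by
  refine sup_le ?_ ?_
  · rintro _ ⟨u, hu, rfl⟩
    refine ⟨?_, fun P hP => by simp [hfS P hP]⟩
    simpa [add_comm, add_left_comm] using hf.mul hu
  · rintro _ ⟨u, hu, rfl⟩
    refine ⟨?_, fun P hP => by simp [hgS P hP]⟩
    simpa [add_comm, add_left_comm] using hg.mul hu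

lemma card_le_mul_of_isRelPrime {f g : TernaryPoly} {d e : ℕ} (hf : f.IsHomogeneous d)
    (hg : g.IsHomogeneous e) (hf0 : f ≠ 0) (hg0 : g ≠ 0) (hfg : IsRelPrime f g)
    {S : Finset RealPlane} (hfS : ∀ P ∈ S, eval P.rep f = 0) (hgS : ∀ P ∈ S, eval P.rep g = 0) :
    S.card ≤ d * e := by
  have h1 := finrank_forms_le_finrank_sup_add_mul (e := e) hf hf0 hg0
    (fun a h => hfg.dvd_of_dvd_mul_left h) (2 * S.card)
  have h2 := Submodule.finrank_mono
    (sup_multiples_le_formsThrough hf hg (S := S) hfS hgS (2 * S.card))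
  have h3 := finrank_formsThrough S (n := 2 * S.card + d + e) (by omega)
  omega

/-- If two curves of degrees `d` and `e` meet in `d * e` real points, then every form of large
degree through these points lies in the ideal generated by the two equations. -/
lemma exists_eq_add_of_card_eq_mul {f g : TernaryPoly} {d e : ℕ} (hf : f.IsHomogeneous d)
    (hg : g.IsHomogeneous e) (hf0 : f ≠ 0) (hg0 : g ≠ 0) (hfg : IsRelPrime f g)
    {S : Finset RealPlane} (hfS : ∀ P ∈ S, eval P.rep f = 0) (hgS : ∀ P ∈ S, eval P.rep g = 0)
    (hS : S.card = d * e) {N : ℕ} (hN : 2 * S.card ≤ N) {u : TernaryPoly}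
    (hu : u.IsHomogeneous (N + d + e)) (huS : ∀ P ∈ S, eval P.rep u = 0) :
    ∃ a b, b.IsHomogeneous (N + d) ∧ u = f * a + g * b := by
  have h1 := finrank_forms_le_finrank_sup_add_mul (e := e) hf hf0 hg0
    (fun a h => hfg.dvd_of_dvd_mul_left h) N
  have h3 := finrank_formsThrough S (n := N + d + e) (by omega)
  have h4 := Submodule.eq_of_le_of_finrank_le
    (sup_multiples_le_formsThrough hf hg (S := S) hfS hgS N) (by omega)
  have h5 : u ∈ formsThrough (N + d + e) S := ⟨hu, huS⟩
  rw [← h4] at h5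
  obtain ⟨_, ⟨a, -, rfl⟩, _, ⟨b, hb, rfl⟩, rfl⟩ := Submodule.mem_sup.1 h5
  exact ⟨a, b, hb, rfl⟩

/-! ### Ideals without projective zeros -/

/-- The projective Nullstellensatz: an ideal without zeros in the complex projective plane contains
all forms of large degree. -/
lemma exists_forall_form_mem (I : Ideal TernaryPoly)
    (h : ∀ x : Fin 3 → ℂ, x ≠ 0 → ∃ p ∈ I, aeval x p ≠ 0) :
    ∃ M, ∀ N ≥ M, ∀ u : TernaryPoly, u.IsHomogeneous N → u ∈ I := by
  set m : Ideal TernaryPoly := Ideal.span (Set.range X)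
  have hm : m ≤ I.radical := by
    rw [Ideal.span_le]
    rintro _ ⟨i, rfl⟩
    rw [← vanishingIdeal_zeroLocus_eq_radical (K := ℂ)]
    intro x hx
    by_cases hx0 : x = 0
    · simp [hx0]
    · obtain ⟨p, hp, hpx⟩ := h x hx0
      exact absurd (hx p hp) hpx
  obtain ⟨M, hM⟩ := Ideal.exists_pow_le_of_le_radical_of_fg hm
    (IsNoetherian.noetherian _)
  refine ⟨M, fun N hN u hu => hM (Ideal.pow_le_pow_right hN ?_)⟩
  rw [Ideal.mem_span_pow_iff_exists_isHomogeneous]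
  refine ⟨map C u, hu.map C, ?_⟩
  rw [eval_map]
  exact eval₂_eta u

/-! ### The degree bound -/

/-- Let `h / q` be a quotient of forms whose degrees differ by `m`, with `q` and `h` nonzerodivisors
modulo `f`. If `h / q` is regular in all complex points of the curve `f = 0` and is divisible by the
square of a function vanishing in `P` for every `P ∈ S`, then `2 |S| ≤ m * deg f`.

Indeed, for large `N` multiplication by `h / q` maps the forms of degree `N` modulo `f`
injectively to the forms of degree `N + m` modulo `f`, and the image satisfies the `2 |S|`
independent conditions to vanish to second order along the curve in the points of `S`. -/
theorem two_mul_card_le {f q h : TernaryPoly} {d n m : ℕ} (hf : f.IsHomogeneous d) (hf0 : f ≠ 0)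
    (hq : q.IsHomogeneous n) (hh : h.IsHomogeneous (n + m))
    (hq0 : q ≠ 0) (hh0 : h ≠ 0)
    (hqf : ∀ a, f ∣ q * a → f ∣ a) (hhf : ∀ a, f ∣ h * a → f ∣ a)
    (hreg : ∀ x : Fin 3 → ℂ, x ≠ 0 → aeval x f = 0 →
      ∃ c w : TernaryPoly, aeval x c ≠ 0 ∧ f ∣ h * c - q * w)
    {S : Finset RealPlane} (hfS : ∀ P ∈ S, eval P.rep f = 0)
    (hS : ∀ P ∈ S, ∃ α c w : TernaryPoly, eval P.rep c ≠ 0 ∧ eval P.rep α = 0 ∧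
      f ∣ h * c - q * (α ^ 2 * w)) :
    2 * S.card ≤ m * d := by
  obtain ⟨v, hv, hv'⟩ := exists_tangent_dirDeriv f
  -- The forms `u` for which `u * h / q` is a form modulo `f`.
  let I : Ideal TernaryPoly :=
    Submodule.comap (LinearMap.mulLeft TernaryPoly h) (Ideal.span {f, q})
  have hI : ∀ u, u ∈ I ↔ h * u ∈ Ideal.span {f, q} := fun u => Iff.rfl
  obtain ⟨M, hM⟩ := exists_forall_form_mem I fun x hx => by
    by_cases hfx : aeval x f = 0
    · obtain ⟨c, w, hc, b, hb⟩ := hreg x hx hfx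
      refine ⟨c, (hI c).2 (Ideal.mem_span_pair.2 ⟨b, w, ?_⟩), hc⟩
      linear_combination -hb
    · exact ⟨f, (hI f).2 (Ideal.mul_mem_left _ _ (Ideal.subset_span (by simp))), hfx⟩
  set N := M + 2 * S.card
  set A := N + d
  set E := forms (A + m) ⊓ LinearMap.ker (jets S v)
  have hE : Module.finrank ℝ E + 2 * S.card = Module.finrank ℝ (forms (A + m)) :=
    finrank_inf_ker_jets S hv' (by omega)
  have hmemE : ∀ a, a.IsHomogeneous (N + m) → f * a ∈ E := fun a ha =>
    ⟨by have := hf.mul ha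
        rwa [show d + (N + m) = A + m by omega] at this,
      mem_ker_jets.2 fun P hP => ⟨by simp [hfS P hP], by simp [dirDeriv_mul, hfS P hP, hv P]⟩⟩
  have hle : multiples f (forms (N + n + m)) ⊔ multiples h (forms A) ≤
      multiples f (forms (N + n + m)) ⊔ multiples q E := by
    refine sup_le le_sup_left ?_
    rintro _ ⟨u, hu, rfl⟩
    have huI := (hI u).1 (hM A (by omega) u hu)
    obtain ⟨a, b, hab⟩ := Ideal.mem_span_pair.1 huI
    have hhu : (h * u).IsHomogeneous (n + (A + m)) := by
      have := hh.mul hu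
      rwa [show n + m + A = n + (A + m) by omega] at this
    -- Pass to the homogeneous components of the right degrees.
    have key : h * u = f * homogeneousComponent (N + n + m) a +
        q * homogeneousComponent (A + m) b := by
      rw [← homogeneousComponent_mul hf, ← homogeneousComponent_mul hq,
        show d + (N + n + m) = n + (A + m) by omega, ← map_add,
        ← homogeneousComponent_eq_self hhu, ← hab]
      congr 1; ring
    set e := homogeneousComponent (A + m) b
    have he : e ∈ E := by
      refine ⟨homogeneousComponent_isHomogeneous _ _, mem_ker_jets.2 fun P hP => ?_⟩
      obtain ⟨α, c, w, hc, hα, hw⟩ := hS P hP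
      obtain ⟨r, hr⟩ : f ∣ e * c - α * (α * (w * u)) := by
        refine hqf _ ?_
        have h1 : q * (e * c - α * (α * (w * u))) =
            (h * c - q * (α ^ 2 * w)) * u - f * (homogeneousComponent (N + n + m) a * c) := by
          linear_combination (-c) * key
        rw [h1]
        exact dvd_sub (hw.mul_right _) (dvd_mul_right _ _)
      have hr' : e * c = α * (α * (w * u)) + f * r := by linear_combination hr
      have h1 : eval P.rep e = 0 := by
        have := congrArg (eval P.rep) hr'
        simpa [hα, hfS P hP, hc] using this
      have h2 := congrArg (dirDeriv P.rep (v P)) hr'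
      exact ⟨h1, by simpa [dirDeriv_mul, hα, hfS P hP, hv P, h1, hc] using h2⟩
    rw [LinearMap.mulLeft_apply, key]
    exact Submodule.add_mem_sup ⟨_, homogeneousComponent_isHomogeneous _ _, rfl⟩ ⟨e, he, rfl⟩
  have hfin := Submodule.finrank_mono hle
  have i1 : multiples f (forms (N + n + m)) ⊓ multiples h (forms A) ≤
      multiples (f * h) (forms N) := by
    rintro x ⟨⟨u, hu, rfl⟩, ⟨w, hw, hx⟩⟩
    simp only [LinearMap.mulLeft_apply] at hx ⊢
    obtain ⟨b, rfl⟩ := hhf w ⟨u, hx⟩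
    exact ⟨b, isHomogeneous_of_mul hf hf0 (by rwa [add_comm d N]), by
      simp only [LinearMap.mulLeft_apply]; rw [← hx]; ring⟩
  have i2 : multiples (f * q) (forms (N + m)) ≤
      multiples f (forms (N + n + m)) ⊓ multiples q E := by
    rintro _ ⟨u, hu, rfl⟩
    refine ⟨⟨q * u, ?_, by simp only [LinearMap.mulLeft_apply, mul_assoc]⟩, ⟨f * u, hmemE u hu, by simp; ring⟩⟩
    have := hq.mul hu
    rwa [show n + (N + m) = N + n + m by omega] at this
  have j1 := Submodule.finrank_mono i1
  have j2 := Submodule.finrank_mono i2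
  have s1 := Submodule.finrank_sup_add_finrank_inf_eq (multiples f (forms (N + n + m)))
    (multiples h (forms A))
  have s2 := Submodule.finrank_sup_add_finrank_inf_eq (multiples f (forms (N + n + m)))
    (multiples q E)
  rw [finrank_multiples (mul_ne_zero hf0 hh0)] at j1
  rw [finrank_multiples (mul_ne_zero hf0 hq0)] at j2
  rw [finrank_multiples hf0, finrank_multiples hh0] at s1
  rw [finrank_multiples hf0, finrank_multiples hq0] at s2
  have e1 := two_mul_finrank_forms N
  have e2 := two_mul_finrank_forms A
  have e3 := two_mul_finrank_forms (N + m)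
  have e4 := two_mul_finrank_forms (A + m)
  have total : 2 * S.card + Module.finrank ℝ (forms A) + Module.finrank ℝ (forms (N + m)) ≤
      Module.finrank ℝ (forms (A + m)) + Module.finrank ℝ (forms N) := by
    omega
  have hA : A = N + d := rfl
  rw [hA] at e2 e4 total
  nlinarith

/-! ### Real forms at real and complex points -/

lemma aeval_smul_of_isHomogeneous {K : Type*} [Field K] [Algebra ℝ K] {p : TernaryPoly} {n : ℕ}
    (hp : p.IsHomogeneous n) (c : K) (x : Fin 3 → K) :
    aeval (c • x) p = c ^ n * aeval x p := by
  rw [aeval_def, aeval_def, eval₂_eq', eval₂_eq', Finset.mul_sum]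
  refine Finset.sum_congr rfl fun d hd => ?_
  have hdeg : ∑ i, d i = n := by
    have := hp (mem_support_iff.1 hd)
    simpa [Finsupp.weight_apply, Finsupp.sum_fintype] using this
  simp only [Pi.smul_apply, smul_eq_mul, mul_pow, Finset.prod_mul_distrib,
    Finset.prod_pow_eq_pow_sum, hdeg]
  ring

lemma aeval_toComplex_rep_eq_zero_iff {p : TernaryPoly} {n : ℕ} (hp : p.IsHomogeneous n)
    (P : RealPlane) : aeval P.toComplex.rep p = 0 ↔ eval P.rep p = 0 := by
  have hne : (fun i => (P.rep i : ℂ)) ≠ 0 := fun h => P.rep_nonzero (funext fun i => by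
    simpa using congrFun h i)
  obtain ⟨a, ha⟩ := Projectivization.exists_smul_eq_mk_rep ℂ (fun i => (P.rep i : ℂ)) hne
  have h1 : P.toComplex.rep = (a : ℂ) • fun i => (P.rep i : ℂ) := ha.symm
  have h2 : aeval (fun i => (P.rep i : ℂ)) p = ((eval P.rep p : ℝ) : ℂ) := by
    simpa [Function.comp_def] using MvPolynomial.aeval_algebraMap_apply ℂ P.rep p
  rw [h1, aeval_smul_of_isHomogeneous hp, h2]
  simp

end TernaryForm

namespace PlaneCurve

open MvPolynomial TernaryForm

variable {f : TernaryPoly}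

/-! ### Rational functions and germs of divisors -/

lemma toFractions_eq_zero_iff {a : TernaryPoly} : toFractions f a = 0 ↔ f ∣ a := by
  rw [toFractions, RingHom.comp_apply,
    IsFractionRing.to_map_eq_zero_iff (R := TernaryPoly ⧸ Ideal.span {f}),
    Ideal.Quotient.eq_zero_iff_mem, Ideal.mem_span_singleton]

lemma toFractions_eq_iff {a b : TernaryPoly} :
    toFractions f a = toFractions f b ↔ f ∣ a - b := by
  rw [← sub_eq_zero, ← map_sub, toFractions_eq_zero_iff]

lemma dvd_of_dvd_mul_of_isUnit {q : TernaryPoly} (hq : IsUnit (toFractions f q)) {a : TernaryPoly}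
    (h : f ∣ q * a) : f ∣ a := by
  rw [← toFractions_eq_zero_iff, map_mul] at h
  exact toFractions_eq_zero_iff.1 ((hq.mul_right_eq_zero).1 h)

lemma isUnit_toFractions {q : TernaryPoly} (hq : ∀ a, f ∣ q * a → f ∣ a) :
    IsUnit (toFractions f q) := by
  have h : Ideal.Quotient.mk (Ideal.span {f}) q ∈ nonZeroDivisors _ := by
    rw [mem_nonZeroDivisors_iff_left]
    intro x hx
    obtain ⟨a, rfl⟩ := Ideal.Quotient.mk_surjective x
    rw [← map_mul, Ideal.Quotient.eq_zero_iff_mem, Ideal.mem_span_singleton] at hx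
    rw [Ideal.Quotient.eq_zero_iff_mem, Ideal.mem_span_singleton]
    exact hq a hx
  exact IsLocalization.map_units (TotalFractions f) ⟨_, h⟩

lemma IsQuotient.isUnit_num {u : (TotalFractions f)ˣ} {p q : TernaryPoly}
    (h : IsQuotient f u p q) : IsUnit (toFractions f p) := by
  rw [← h.2.2]; exact u.isUnit.mul h.2.1

/-- The quotient of two forms of the same degree as an invertible rational function. -/
lemma exists_rationalUnit {p q : TernaryPoly} {n : ℕ} (hp : p.IsHomogeneous n)
    (hq : q.IsHomogeneous n) (hpu : IsUnit (toFractions f p)) (hqu : IsUnit (toFractions f q)) :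
    ∃ u : RationalUnits f, IsQuotient f (u : (TotalFractions f)ˣ) p q := by
  obtain ⟨a, ha⟩ := hpu
  obtain ⟨b, hb⟩ := hqu
  have h : IsQuotient f ((a * b⁻¹ : (TotalFractions f)ˣ)) p q :=
    ⟨⟨n, hp, hq⟩, hb ▸ b.isUnit, by rw [← ha, ← hb]; simp⟩
  exact ⟨⟨a * b⁻¹, p, q, h⟩, h⟩

lemma IsQuotient.mul {u v : TotalFractions f} {p q p' q' : TernaryPoly}
    (h : IsQuotient f u p q) (h' : IsQuotient f v p' q') :
    IsQuotient f (u * v) (p * p') (q * q') := by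
  obtain ⟨⟨n, hp, hq⟩, hu, h⟩ := h
  obtain ⟨⟨n', hp', hq'⟩, hu', h'⟩ := h'
  refine ⟨⟨n + n', hp.mul hp', hq.mul hq'⟩, ?_, ?_⟩
  · rw [map_mul]; exact hu.mul hu'
  · rw [map_mul, map_mul, ← h, ← h']; ring

lemma isQuotient_one : IsQuotient f 1 1 1 :=
  ⟨⟨0, isHomogeneous_one _ _, isHomogeneous_one _ _⟩, by simp, by simp⟩

lemma germ_eq_one_iff {x : complexPoints f} {u : RationalUnits f} :
    germ f x u = 1 ↔ u ∈ UnitsAt f x :=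
  QuotientGroup.eq_one_iff u

/-- Rational functions with the same germ at `x` differ by a unit `a / b` of the local ring. -/
lemma exists_of_germ_eq {x : complexPoints f} {u v : RationalUnits f}
    (h : germ f x u = germ f x v) {p q p' q' : TernaryPoly}
    (hu : IsQuotient f (u : (TotalFractions f)ˣ) p q)
    (hv : IsQuotient f (v : (TotalFractions f)ˣ) p' q') :
    ∃ (k : ℕ) (a b : TernaryPoly), a.IsHomogeneous k ∧ b.IsHomogeneous k ∧
      aeval x.1.rep a ≠ 0 ∧ aeval x.1.rep b ≠ 0 ∧ f ∣ p' * q * b - p * q' * a := by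
  have h1 : u⁻¹ * v ∈ UnitsAt f x := by
    rw [← germ_eq_one_iff, map_mul, map_inv, h, inv_mul_cancel]
  obtain ⟨a, b, hab, ha, hb⟩ := h1
  obtain ⟨⟨k, hka, hkb⟩, -, hw⟩ := hab
  refine ⟨k, a, b, hka, hkb, ha, hb, toFractions_eq_iff.1 ?_⟩
  simp only [map_mul]
  rw [← hw, ← hu.2.2, ← hv.2.2]
  simp only [Subgroup.coe_mul, Subgroup.coe_inv, Units.val_mul]
  have : ((u : (TotalFractions f)ˣ) : TotalFractions f) *
    ((u : (TotalFractions f)ˣ)⁻¹ : (TotalFractions f)ˣ) = 1 := Units.mul_inv _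
  linear_combination (-((v : (TotalFractions f)ˣ) : TotalFractions f) * toFractions f q' *
    toFractions f q * toFractions f b) * this

lemma IsUniformizer.vanishesAt {x : complexPoints f} {t : RationalUnits f}
    (h : IsUniformizer f x t) : VanishesAt f x ((t : (TotalFractions f)ˣ) : TotalFractions f) :=
  (h _).2 ⟨1, ⟨1, 1, isQuotient_one, by simp⟩, (mul_one _).symm⟩

/-- If `∑_{P ∈ S} [P] = τ + [𝒪_X(3)]` with `2 τ = 0`, then there are forms `p`, `q` of the same
degree and a cubic form `s` such that locally `p s² / q` is the square of an equation `α` of the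
divisor `∑_{P ∈ S} P`, up to a factor `w / c` with `c` nonvanishing. -/
lemma exists_local_equations {S : Set RealPlane} {c : Pic f} (hc : IsClassOfPoints f S c)
    (hτ : IsTau f c) : ∃ (n : ℕ) (p q s : TernaryPoly), p.IsHomogeneous n ∧ q.IsHomogeneous n ∧
      s.IsHomogeneous 3 ∧ IsUnit (toFractions f p) ∧ IsUnit (toFractions f q) ∧
      IsUnit (toFractions f s) ∧ ∀ x : complexPoints f, ∃ (k l : ℕ) (α c w : TernaryPoly),
        α.IsHomogeneous k ∧ c.IsHomogeneous l ∧ aeval x.1.rep c ≠ 0 ∧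
        f ∣ p * s ^ 2 * c - q * (α ^ 2 * w) ∧
        (x.1 ∈ RealPlane.toComplex '' S → aeval x.1.rep α = 0) := by
  obtain ⟨D, hD, rfl⟩ := hc
  obtain ⟨τ, _, -, hτ2, -, ⟨O, ⟨s, hs, hsu, hO⟩, rfl⟩, hτ⟩ := hτ
  have h1 : divisorClass f (D ^ 2 * (O ^ 2)⁻¹) = 1 := by
    rw [map_mul, map_inv, map_pow, map_pow, hτ, mul_pow, hτ2, one_mul, mul_inv_cancel]
  obtain ⟨g, hg⟩ := (QuotientGroup.eq_one_iff _).1 h1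
  have hDO : D ^ 2 = principal f g * O ^ 2 := by rw [hg, inv_mul_cancel_right]
  obtain ⟨p, q, hpq⟩ := g.2
  obtain ⟨n, hp, hq⟩ := hpq.1
  refine ⟨n, p, q, s, hp, hq, hs, hpq.isUnit_num, hpq.2.1, hsu, fun x => ?_⟩
  obtain ⟨m, σ, hm, hmx, hσ, hOx⟩ := hO x
  have hloc : D.1 x ^ 2 = germ f x (g * σ ^ 2) := by
    have h2 := congrFun (congrArg Subtype.val hDO) x
    rw [map_mul, map_pow, ← hOx]
    exact h2
  have hv : IsQuotient f ((g * σ ^ 2 : RationalUnits f) : (TotalFractions f)ˣ)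
      (p * (s * s)) (q * (m * m)) := by
    have := hpq.mul (hσ.mul hσ)
    rwa [← Units.val_mul, ← Units.val_mul, ← Subgroup.coe_mul, ← Subgroup.coe_mul, ← sq] at this
  obtain ⟨t, ht, α, β, hαβ, hβ, hα⟩ : ∃ t : RationalUnits f, D.1 x = germ f x t ∧
      ∃ α β, IsQuotient f (t : (TotalFractions f)ˣ) α β ∧ aeval x.1.rep β ≠ 0 ∧
        (x.1 ∈ RealPlane.toComplex '' S → aeval x.1.rep α = 0) := by
    by_cases hx : x.1 ∈ RealPlane.toComplex '' S
    · obtain ⟨t, ht, hDt⟩ := (hD x).1 hx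
      obtain ⟨α, β, h, hβ, hα⟩ := ht.vanishesAt
      exact ⟨t, hDt, α, β, h, hβ, fun _ => hα⟩
    · exact ⟨1, by rw [(hD x).2 hx, map_one], 1, 1, isQuotient_one, by simp, fun h => absurd h hx⟩
  have hu : IsQuotient f ((t ^ 2 : RationalUnits f) : (TotalFractions f)ˣ) (α * α) (β * β) := by
    have := hαβ.mul hαβ
    rwa [← Units.val_mul, ← Subgroup.coe_mul, ← sq] at this
  rw [ht, ← map_pow] at hloc
  obtain ⟨k, a, b, ha, hb, hax, hbx, hdvd⟩ := exists_of_germ_eq hloc hu hv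
  obtain ⟨⟨e, hα', hβ'⟩, -⟩ := hαβ
  refine ⟨e, e + e + k, α, β * β * b, m * m * a, hα', (hβ'.mul hβ').mul hb, ?_, ?_, hα⟩
  · rw [map_mul, map_mul]; exact mul_ne_zero (mul_ne_zero hβ hβ) hbx
  · convert! hdvd using 1; ring

/-! ### The class of the nine points -/

lemma IsRegularRealPoint.eval_right_ne_zero {a b : TernaryPoly} {P : RealPlane}
    (h : IsRegularRealPoint (a * b) P) (ha : eval P.rep a = 0) : eval P.rep b ≠ 0 := by
  intro hb
  obtain ⟨i, hi⟩ := h.2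
  simp [Derivation.leibniz, ha, hb] at hi

/-- The relation `2 ∑_{P ∈ S} [P] = 2 [𝒪_X(3)]`, restricted to the part `f₁ = 0` of `X`, bounds the
number of points of `S` on this part. -/
lemma card_filter_le {f₁ f₂ : TernaryPoly} {d₁ : ℕ} (hf₁ : f₁.IsHomogeneous d₁)
    (hf0 : f₁ * f₂ ≠ 0) {S : Finset RealPlane} {c : Pic (f₁ * f₂)}
    (hc : IsClassOfPoints (f₁ * f₂) S c) (hτ : IsTau (f₁ * f₂) c) :
    (S.filter fun P => eval P.rep f₁ = 0).card ≤ 3 * d₁ := by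
  obtain ⟨n, p, q, s, hp, hq, hs, hpu, hqu, hsu, H⟩ := exists_local_equations hc hτ
  have hf₁0 := left_ne_zero_of_mul hf0
  have hf₂0 := right_ne_zero_of_mul hf0
  -- A nonzerodivisor modulo `f₁ * f₂` is one modulo `f₁`.
  have hnzd : ∀ u : TernaryPoly, IsUnit (toFractions (f₁ * f₂) u) → ∀ a, f₁ ∣ u * a → f₁ ∣ a := by
    intro u hu a ha
    have : f₁ * f₂ ∣ u * (a * f₂) := by rw [← mul_assoc]; exact mul_dvd_mul_right ha f₂
    exact (mul_dvd_mul_iff_right hf₂0).1 (dvd_of_dvd_mul_of_isUnit hu this)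
  have hnonunit : ∀ u : TernaryPoly, IsUnit (toFractions (f₁ * f₂) u) →
      ¬ IsUnit f₁ → u ≠ 0 := by
    rintro u hu h1 rfl
    exact h1 (isUnit_of_dvd_one (hnzd 0 hu 1 (by simp)))
  by_cases hunit : IsUnit f₁
  · have : S.filter (fun P => eval P.rep f₁ = 0) = ∅ := by
      refine Finset.filter_eq_empty_iff.2 fun P _ h => ?_
      exact (hunit.map (eval P.rep)).ne_zero h
    simp [this]
  have hhu : IsUnit (toFractions (f₁ * f₂) (p * s ^ 2)) := by
    rw [map_mul, map_pow]; exact hpu.mul (hsu.pow 2)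
  have key := two_mul_card_le (q := q) (h := p * s ^ 2) (n := n) (m := 6) hf₁ hf₁0 hq
    (hp.mul (hs.pow 2)) (hnonunit _ hqu hunit) (hnonunit _ hhu hunit) (hnzd _ hqu) (hnzd _ hhu)
    (fun x hx hfx => ?_) (S := S.filter fun P => eval P.rep f₁ = 0)
    (fun P hP => (Finset.mem_filter.1 hP).2) (fun P hP => ?_)
  · omega
  · obtain ⟨a, ha⟩ := Projectivization.exists_smul_eq_mk_rep ℂ x hx
    have hrep : (Projectivization.mk ℂ x hx).rep = (a : ℂ) • x := ha.symm
    have hmem : Projectivization.mk ℂ x hx ∈ complexPoints (f₁ * f₂) := by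
      show aeval _ _ = 0
      rw [map_mul, hrep, aeval_smul_of_isHomogeneous hf₁, hfx]; simp
    obtain ⟨k, l, α, c, w, -, hc, hcx, hdvd, -⟩ := H ⟨_, hmem⟩
    refine ⟨c, α ^ 2 * w, fun h => hcx ?_, (dvd_mul_right _ _).trans hdvd⟩
    rw [hrep, aeval_smul_of_isHomogeneous hc, h, mul_zero]
  · obtain ⟨hPS, hPf⟩ := Finset.mem_filter.1 hP
    have hmem : P.toComplex ∈ complexPoints (f₁ * f₂) := by
      show aeval _ _ = 0
      rw [map_mul, (aeval_toComplex_rep_eq_zero_iff hf₁ P).2 hPf, zero_mul]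
    obtain ⟨k, l, α, c, w, hα, hc, hcx, hdvd, hαx⟩ := H ⟨_, hmem⟩
    exact ⟨α, c, w, fun h => hcx ((aeval_toComplex_rep_eq_zero_iff hc P).2 h),
      (aeval_toComplex_rep_eq_zero_iff hα P).1 (hαx ⟨P, hPS, rfl⟩),
      (dvd_mul_right _ _).trans hdvd⟩

/-- As the bound holds for complementary parts `f₁ = 0` and `f₂ = 0` of the cubic `X`, it is an
equality for both. -/
lemma card_filter_eq {f₁ f₂ : TernaryPoly} {d₁ d₂ : ℕ} (hf₁ : f₁.IsHomogeneous d₁)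
    (hf₂ : f₂.IsHomogeneous d₂) (hd : d₁ + d₂ = 3) (hf0 : f₁ * f₂ ≠ 0) {S : Finset RealPlane}
    (hcard : S.card = 9) (hreg : ∀ P ∈ S, IsRegularRealPoint (f₁ * f₂) P) {c : Pic (f₁ * f₂)}
    (hc : IsClassOfPoints (f₁ * f₂) S c) (hτ : IsTau (f₁ * f₂) c) :
    (S.filter fun P => eval P.rep f₁ = 0).card = 3 * d₁ := by
  classical
  have h1 := card_filter_le hf₁ hf0 hc hτ
  have h2 : (S.filter fun P => eval P.rep f₂ = 0).card ≤ 3 * d₂ := by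
    have e := mul_comm f₁ f₂
    clear h1 hreg
    revert c hf0
    rw [e]
    intro hf0 c hc hτ
    exact card_filter_le hf₂ hf0 hc hτ
  have h3 : S ⊆ (S.filter fun P => eval P.rep f₁ = 0) ∪ (S.filter fun P => eval P.rep f₂ = 0) := by
    intro P hP
    have := (hreg P hP).1
    rw [map_mul, mul_eq_zero] at this
    simpa [hP] using this
  have h4 := (Finset.card_le_card h3).trans (Finset.card_union_le _ _)
  omega

/-- If a cubic `g` without common component with `X` passes through the nine points of `S`, then
it meets `X` in these points only, and transversally. So `∑_{P ∈ S} P` is the divisor of `g`. -/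
lemma class_eq_of_isRelPrime {g : TernaryPoly} (hf : f.IsHomogeneous 3) (hf0 : f ≠ 0)
    (hg : g.IsHomogeneous 3) (hg0 : g ≠ 0) (hfg : IsRelPrime f g) {S : Finset RealPlane}
    (hcard : S.card = 9) (hfS : ∀ P ∈ S, eval P.rep f = 0) (hgS : ∀ P ∈ S, eval P.rep g = 0)
    {c o : Pic f} (hc : IsClassOfPoints f S c) (ho : IsTwistClass f 3 o) : c = o := by
  classical
  obtain ⟨D, hD, rfl⟩ := hc
  obtain ⟨O, ⟨s, hs, hsu, hO⟩, rfl⟩ := ho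
  have hgu : IsUnit (toFractions f g) :=
    isUnit_toFractions fun a h => hfg.dvd_of_dvd_mul_left h
  obtain ⟨G, hG⟩ := exists_rationalUnit hg hs hgu hsu
  suffices h : D = principal f G * O by
    rw [h, map_mul, mul_eq_right]
    exact (QuotientGroup.eq_one_iff _).2 ⟨G, rfl⟩
  refine Subtype.ext (funext fun x => ?_)
  obtain ⟨m, σ, hm, hmx, hσ, hOx⟩ := hO x
  have hGσ : IsQuotient f ((G * σ : RationalUnits f) : (TotalFractions f)ˣ) g m := by
    refine ⟨⟨3, hg, hm⟩, hσ.2.1, ?_⟩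
    rw [Subgroup.coe_mul, Units.val_mul, mul_assoc, hσ.2.2, hG.2.2]
  have hfx : aeval x.1.rep f = 0 := x.2
  show D.1 x = germ f x G * O.1 x
  rw [hOx, ← map_mul]
  by_cases hx : x.1 ∈ RealPlane.toComplex '' (S : Set RealPlane)
  · obtain ⟨t, ht, hDt⟩ := (hD x).1 hx
    obtain ⟨P, hPS, hPx⟩ := hx
    have hPx' : ∀ {p : TernaryPoly} {n : ℕ}, p.IsHomogeneous n →
        (aeval x.1.rep p = 0 ↔ eval P.rep p = 0) := fun hp => by
      rw [← hPx]; exact aeval_toComplex_rep_eq_zero_iff hp P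
    obtain ⟨α, β, hαβ, hβx, hαx⟩ := ht.vanishesAt
    obtain ⟨k, hα, hβ⟩ := hαβ.1
    obtain ⟨b, ⟨p₁, q₁, hb, hq₁x⟩, hbt⟩ :=
      (ht _).1 ⟨g, m, hGσ, hmx, (hPx' hg).2 (hgS P hPS)⟩
    -- A form that vanishes in the other points of `S`.
    obtain ⟨v, -, hv⟩ := exists_tangent_dirDeriv 0
    obtain ⟨U, hU, hUS⟩ := exists_form_jet S hv (n := 24) (by omega)
      fun Q => (if Q = ⟨P, hPS⟩ then 1 else 0, 0)
    have hUx : aeval x.1.rep U ≠ 0 := by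
      rw [Ne, hPx' hU, (hUS ⟨P, hPS⟩).1]; simp
    obtain ⟨A, B, hB, hAB⟩ := exists_eq_add_of_card_eq_mul hf hg hf0 hg0 hfg hfS hgS
      (by omega) (N := k + 18) (by omega) (u := α * U) (hα.mul hU) fun Q hQ => by
        by_cases hQP : Q = P
        · rw [hQP, map_mul, (hPx' hα).1 hαx, zero_mul]
        · have := (hUS ⟨Q, hQ⟩).1
          rw [map_mul, this]
          simp [hQP]
    have hrel : f ∣ U * β * q₁ - p₁ * m * B := by
      refine dvd_of_dvd_mul_of_isUnit hαβ.isUnit_num (toFractions_eq_zero_iff.1 ?_)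
      have e1 : toFractions f (α * U) = toFractions f (g * B) :=
        toFractions_eq_iff.2 ⟨A, by rw [hAB]; ring⟩
      have e2 := hαβ.2.2
      have e3 := hb.2.2
      have e4 := hGσ.2.2
      rw [hbt] at e4
      simp only [map_mul, map_sub] at e1 ⊢
      rw [← e4] at e1
      rw [← e3]
      linear_combination (toFractions f β * toFractions f q₁) * e1 -
        (b * toFractions f q₁ * toFractions f m * toFractions f B) * (-e2)
    have hp₁x : aeval x.1.rep p₁ ≠ 0 := by
      intro h0
      obtain ⟨r, hr⟩ := hrel
      have := congrArg (aeval x.1.rep) hr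
      simp [h0, hfx, hUx, hβx, hq₁x] at this
    have hw : t⁻¹ * (G * σ) ∈ UnitsAt f x := by
      refine ⟨p₁, q₁, ?_, hp₁x, hq₁x⟩
      have : (((t⁻¹ * (G * σ) : RationalUnits f) : (TotalFractions f)ˣ) : TotalFractions f) = b := by
        rw [Subgroup.coe_mul, Units.val_mul, hbt, Subgroup.coe_inv, Units.inv_mul_cancel_left]
      rwa [this]
    rw [hDt]
    exact QuotientGroup.eq.2 hw
  · rw [(hD x).2 hx, eq_comm, germ_eq_one_iff]
    refine ⟨g, m, hGσ, fun hgx => ?_, hmx⟩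
    -- A form that vanishes in `S` but not in `x` is not in the ideal `(f, g)`.
    have hl : ∀ Q : RealPlane, ∃ l : TernaryPoly, l.IsHomogeneous 1 ∧
        (Q ∈ S → eval Q.rep l = 0 ∧ aeval x.1.rep l ≠ 0) := by
      intro Q
      by_cases hQ : Q ∈ S
      · obtain ⟨l, h1, h2, h3⟩ := exists_linearForm Q.rep_nonzero (x := x.1.rep) fun c h => by
          refine hx ⟨Q, hQ, ?_⟩
          rw [← x.1.mk_rep, RealPlane.toComplex, eq_comm, Projectivization.mk_eq_mk_iff']
          exact ⟨c, h.symm⟩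
        exact ⟨l, h1, fun _ => ⟨h2, h3⟩⟩
      · exact ⟨0, isHomogeneous_zero _ _ _, fun h => absurd h hQ⟩
    choose l hl1 hl2 using hl
    obtain ⟨j, hj⟩ := Function.ne_iff.1 x.1.rep_nonzero
    have hu : (X j ^ 15 * ∏ Q ∈ S, l Q : TernaryPoly).IsHomogeneous (18 + 3 + 3) := by
      have := (isHomogeneous_X_pow (R := ℝ) j 15).mul
        (IsHomogeneous.prod S l (fun _ => 1) fun Q _ => hl1 Q)
      simpa [hcard] using this
    obtain ⟨A, B, -, hAB⟩ := exists_eq_add_of_card_eq_mul hf hg hf0 hg0 hfg hfS hgS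
      (by omega) (N := 18) (by omega) hu fun Q hQ => by
        rw [map_mul, map_prod, Finset.prod_eq_zero hQ (hl2 Q hQ).1, mul_zero]
    have := congrArg (aeval x.1.rep) hAB
    rw [map_add, map_mul _ f, map_mul _ g, hfx, hgx, zero_mul, zero_mul, add_zero, map_mul, map_pow,
      map_prod, aeval_X, mul_eq_zero] at this
    rcases this with h | h
    · exact hj (pow_eq_zero_iff (by norm_num) |>.1 h)
    · obtain ⟨Q, hQ, h⟩ := Finset.prod_eq_zero_iff.1 h
      exact (hl2 Q hQ).2 h

end PlaneCurve

namespace TernaryForm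

open MvPolynomial Filter Topology

/-! ### Real points near a nonsingular real point -/

lemma hasDerivAt_eval_add_smul (y e : Fin 3 → ℝ) (p : TernaryPoly) :
    HasDerivAt (fun t : ℝ => eval (y + t • e) p) (dirDeriv y e p) 0 := by
  induction p using MvPolynomial.induction_on with
  | C r => simpa [dirDeriv] using hasDerivAt_const (0 : ℝ) r
  | add p q hp hq =>
    simp only [map_add]
    exact hp.add hq
  | mul_X p i hp =>
    have hX : HasDerivAt (fun t : ℝ => y i + t * e i) (e i) 0 := by
      simpa using ((hasDerivAt_id (0 : ℝ)).mul_const (e i)).const_add (y i)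
    have h := hp.mul hX
    have hd : dirDeriv y e (X i : TernaryPoly) = e i := by
      rw [dirDeriv_linearForm _ _ (isHomogeneous_X ℝ i), eval_X]
    rw [dirDeriv_mul, hd, eval_X]
    convert! h using 1
    · funext t
      simp
    · simp

lemma exists_opposite_signs {F : ℝ → ℝ} {F' : ℝ} (hF : HasDerivAt F F' 0) (h0 : F 0 = 0)
    (hF' : F' ≠ 0) : ∃ t, F t * F (-t) < 0 := by
  have h1 := hasDerivAt_iff_tendsto_slope_zero.1 hF
  have h2 : ∀ᶠ t in 𝓝[≠] (0 : ℝ), 0 < t⁻¹ * F t * F' := by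
    have h3 := h1.mul_const F'
    have h4 : 0 < F' * F' := mul_self_pos.2 hF'
    simpa [h0] using h3.eventually (lt_mem_nhds h4)
  obtain ⟨ε, hε, h3⟩ := Metric.eventually_nhds_iff.1 (eventually_nhdsWithin_iff.1 h2)
  have hd : |ε| / 2 < ε := by rw [abs_of_pos hε]; linarith
  have h4 := h3 (y := ε / 2) (by simpa [Real.dist_eq] using hd) (by simp; positivity)
  have h5 := h3 (y := -(ε / 2)) (by simpa [Real.dist_eq] using hd) (by simp; positivity)
  refine ⟨ε / 2, ?_⟩
  have h6 := mul_pos h4 h5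
  have h7 : (ε / 2)⁻¹ * F (ε / 2) * F' * ((-(ε / 2))⁻¹ * F (-(ε / 2)) * F') =
      -(F (ε / 2) * F (-(ε / 2))) * ((ε / 2)⁻¹ * F') ^ 2 := by
    rw [inv_neg]; ring
  rw [h7] at h6
  have := pos_of_mul_pos_left h6 (sq_nonneg _)
  linarith

/-- A real form has infinitely many real zeros if it has a nonsingular one: near such a zero it
changes sign along each of the lines in a pencil of parallel lines. -/
lemma infinite_zeros {a : TernaryPoly} {d : ℕ} (ha : a.IsHomogeneous d) {P : RealPlane}
    (hP : PlaneCurve.IsRegularRealPoint a P) : {Q : RealPlane | eval Q.rep a = 0}.Infinite := by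
  obtain ⟨hP0, i, hi⟩ := hP
  set y := P.rep with hy
  set e : Fin 3 → ℝ := Pi.single i 1 with he
  have hde : dirDeriv y e a ≠ 0 := by
    have : dirDeriv y e a = eval y (pderiv i a) := by
      simp [dirDeriv, he, Pi.single_apply]
    rwa [this]
  have hdy : dirDeriv y y a = 0 := by
    have := congrArg (eval y) ha.sum_X_mul_pderiv
    simpa [dirDeriv, hP0] using this
  -- By Euler's identity the direction `e` is transversal to `y`.
  have hey : ∀ c : ℝ, e ≠ c • y := by
    intro c hc
    apply hde
    rw [hc]
    have : dirDeriv y (c • y) a = c * dirDeriv y y a := by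
      simp [dirDeriv, Finset.mul_sum, mul_assoc]
    rw [this, hdy, mul_zero]
  obtain ⟨u, hu⟩ : ∃ u : Fin 3 → ℝ, u ∉ Submodule.span ℝ {y, e} := by
    by_contra! H
    have h1 : Submodule.span ℝ {y, e} = ⊤ := Submodule.eq_top_iff'.2 H
    classical
    have h2 := finrank_span_finset_le_card (R := ℝ) ({y, e} : Finset (Fin 3 → ℝ))
    rw [Finset.coe_pair, Set.finrank, h1, finrank_top, Module.finrank_fin_fun] at h2
    have := h2.trans Finset.card_le_two
    omega
  obtain ⟨t, ht⟩ := exists_opposite_signs (hasDerivAt_eval_add_smul y e a) (by simpa using hP0) hde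
  have hcont : Continuous fun x : Fin 3 → ℝ => eval x a := MvPolynomial.continuous_eval a
  have hev : ∀ᶠ s in 𝓝 (0 : ℝ),
      eval (y + s • u + t • e) a * eval (y + s • u + (-t) • e) a < 0 := by
    have hc : Continuous fun s : ℝ =>
        eval (y + s • u + t • e) a * eval (y + s • u + (-t) • e) a :=
      (hcont.comp (by fun_prop)).mul (hcont.comp (by fun_prop))
    refine hc.continuousAt.eventually (gt_mem_nhds ?_)
    simpa using ht
  obtain ⟨δ, hδ, hev⟩ := Metric.eventually_nhds_iff.1 hev
  have hzero : ∀ s ∈ Set.Ioo (0 : ℝ) δ, ∃ r : ℝ, eval (y + s • u + r • e) a = 0 := by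
    intro s hs
    have h1 := hev (y := s) (by simpa [Real.dist_eq, abs_of_pos hs.1] using hs.2)
    have hc : Continuous fun r : ℝ => eval (y + s • u + r • e) a :=
      hcont.comp (by fun_prop)
    rcases mul_neg_iff.1 h1 with ⟨h2, h3⟩ | ⟨h2, h3⟩
    · exact mem_range_of_exists_le_of_exists_ge hc ⟨-t, h3.le⟩ ⟨t, h2.le⟩
    · exact mem_range_of_exists_le_of_exists_ge hc ⟨t, h2.le⟩ ⟨-t, h3.le⟩
  choose! r hr using hzero
  have hye : ∀ b c : ℝ, b • y + c • e ∈ Submodule.span ℝ {y, e} := fun b c =>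
    Submodule.mem_span_pair.2 ⟨b, c, rfl⟩
  have hind : ∀ α β γ : ℝ, α • y + β • u + γ • e = 0 → β = 0 ∧ α = 0 := by
    intro α β γ h
    have hβ : β = 0 := by
      by_contra hβ
      apply hu
      have : u = (-(β⁻¹ * α)) • y + (-(β⁻¹ * γ)) • e := by
        have h2 : β⁻¹ • (α • y + β • u + γ • e) = 0 := by rw [h, smul_zero]
        funext j
        have h3 := congrFun h2 j
        simp only [Pi.smul_apply, Pi.add_apply, smul_eq_mul, Pi.zero_apply] at h3 ⊢
        field_simp at h3 ⊢
        linarith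
      rw [this]; exact hye _ _
    refine ⟨hβ, ?_⟩
    by_contra hα
    have hγ : γ ≠ 0 := by
      rintro rfl
      rw [hβ] at h
      simp only [zero_smul, add_zero, smul_eq_zero] at h
      exact h.elim hα P.rep_nonzero
    refine hey (-(γ⁻¹ * α)) (funext fun j => ?_)
    have h3 := congrFun h j
    simp only [Pi.smul_apply, Pi.add_apply, smul_eq_mul, Pi.zero_apply, hβ] at h3 ⊢
    field_simp
    linarith
  have hne : ∀ s : ℝ, y + s • u + r s • e ≠ 0 := fun s h => by
    have := hind 1 s (r s) (by rwa [one_smul])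
    exact one_ne_zero this.2
  let Φ : ℝ → RealPlane := fun s => Projectivization.mk ℝ _ (hne s)
  have hinj : Set.InjOn Φ (Set.Ioo 0 δ) := by
    intro s _ s' _ h
    obtain ⟨c, hc⟩ := (Projectivization.mk_eq_mk_iff' _ _ _ _ _).1 h
    have h1 := hind (c - 1) (c * s' - s) (c * r s' - r s) (by
      funext j
      have := congrFun hc j
      simp only [Pi.smul_apply, Pi.add_apply, smul_eq_mul, Pi.zero_apply] at this ⊢
      linear_combination this)
    have hc1 : c = 1 := by linarith [h1.2]
    have := h1.1
    rw [hc1] at this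
    linarith
  refine ((Set.Ioo_infinite hδ).image hinj).mono ?_
  rintro _ ⟨s, hs, rfl⟩
  obtain ⟨b, hb⟩ := Projectivization.exists_smul_eq_mk_rep ℝ _ (hne s)
  have hrep : (Φ s).rep = (b : ℝ) • (y + s • u + r s • e) := hb.symm
  have h1 : aeval ((b : ℝ) • (y + s • u + r s • e)) a = 0 := by
    rw [aeval_smul_of_isHomogeneous ha]
    simp [hr s hs]
  show eval (Φ s).rep a = 0
  rw [hrep]
  simpa using h1

end TernaryForm

namespace PlaneCurve

open MvPolynomial TernaryForm

/-! ### The cubics through the nine points -/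

lemma isUnit_of_isHomogeneous_zero {a : TernaryPoly} (h : a.IsHomogeneous 0) (h0 : a ≠ 0) :
    IsUnit a := by
  have h1 := (totalDegree_zero_iff_isHomogeneous _).2 h
  rw [totalDegree_eq_zero_iff_eq_C] at h1
  rw [h1] at h0 ⊢
  exact (isUnit_iff_ne_zero.2 fun h => h0 (by rw [h, C_0])).map C

lemma IsRegularRealPoint.left {a b : TernaryPoly} {P : RealPlane}
    (h : IsRegularRealPoint (a * b) P) (ha : eval P.rep a = 0) : IsRegularRealPoint a P := by
  obtain ⟨i, hi⟩ := h.2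
  refine ⟨ha, i, fun h0 => hi ?_⟩
  simp [Derivation.leibniz, ha, h0]

/-- If every part of positive degree of a reduced curve has a real point at which the curve is
nonsingular, then the real points are dense. -/
lemma realPointsDense_of_forall_factor {f : TernaryPoly} {n : ℕ} (hf : f.IsHomogeneous n)
    (hf0 : f ≠ 0) (hsq : Squarefree f)
    (H : ∀ (a b : TernaryPoly) (d : ℕ), f = a * b → a.IsHomogeneous d → d ≠ 0 →
      ∃ P : RealPlane, IsRegularRealPoint f P ∧ eval P.rep a = 0) :
    RealPointsDense f := by
  intro d h hh hvan
  refine Ideal.le_radical (Ideal.mem_span_singleton.2 ?_)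
  by_cases hh0 : h = 0
  · rw [hh0]; exact dvd_zero f
  obtain ⟨a, b, c, hab, hca, hcb⟩ := UniqueFactorizationMonoid.exists_reduced_factors f hf0 h
  have hac : f = a * c := by rw [← hca, mul_comm]
  obtain ⟨j, i, -, hj, hi⟩ := isHomogeneous_factors (hac ▸ hf) (hac ▸ hf0)
  have ha0 : a ≠ 0 := left_ne_zero_of_mul (hac ▸ hf0)
  by_cases hj0 : j = 0
  · subst hj0
    rw [← hca, ← hcb]
    exact mul_dvd_mul_left c (isUnit_of_isHomogeneous_zero hj ha0).dvd
  exfalso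
  obtain ⟨P, hP, hPa⟩ := H a c j hac hj hj0
  rw [hac] at hP
  have hinf := infinite_zeros hj (hP.left hPa)
  have hrel : IsRelPrime a h := by
    rw [← hcb]
    exact (IsRelPrime.of_squarefree_mul (hac ▸ hsq)).mul_right hab
  obtain ⟨T, hT, hTcard⟩ := hinf.exists_subset_card_eq (j * d + 1)
  have := card_le_mul_of_isRelPrime hj hh ha0 hh0 hrel (S := T) (fun Q hQ => hT hQ)
    (fun Q hQ => hvan Q (by rw [hac, map_mul, show eval Q.rep a = 0 from hT hQ, zero_mul]))
  omega

/-- A cubic through the nine points of `S` is a multiple of the equation of `X`. Otherwise, without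
the greatest common divisor the two cubics would become curves of degree `j > 0`, meeting in `3 j`
points of `S`. By Bézout `j = 3`, and then `∑_{P ∈ S} [P]` is the class of `𝒪_X(3)`. -/
lemma exists_eq_smul_of_mem_formsThrough {f : TernaryPoly} (hf : f.IsHomogeneous 3)
    (hf0 : f ≠ 0) {S : Finset RealPlane} (hcard : S.card = 9)
    (hreg : ∀ P ∈ S, IsRegularRealPoint f P) {c : Pic f} (hc : IsClassOfPoints f S c)
    (hτ : IsTau f c) {g : TernaryPoly} (hg : g ∈ formsThrough 3 (S : Set RealPlane)) :
    ∃ r : ℝ, g = r • f := by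
  by_cases hg0 : g = 0
  · exact ⟨0, by rw [hg0, zero_smul]⟩
  obtain ⟨a, b, e, hab, rfl, rfl⟩ := UniqueFactorizationMonoid.exists_reduced_factors f hf0 g
  obtain ⟨i, j, hij, hi, hj⟩ := isHomogeneous_factors hf hf0
  have he0 := left_ne_zero_of_mul hf0
  have ha0 := right_ne_zero_of_mul hf0
  have hb0 := right_ne_zero_of_mul hg0
  have hb : b.IsHomogeneous j := isHomogeneous_of_mul hi he0 (by rw [hij]; exact hg.1)
  have hcount : (S.filter fun P => eval P.rep a = 0).card = 3 * j := by
    have e1 := mul_comm e a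
    clear hf hg
    revert c hf0
    rw [e1] at hreg ⊢
    intro hf0 c hc hτ
    exact card_filter_eq hj hi (by omega) hf0 hcard hreg hc hτ
  have hbez := card_le_mul_of_isRelPrime hj hb ha0 hb0 hab
    (S := S.filter fun P => eval P.rep a = 0) (fun P hP => (Finset.mem_filter.1 hP).2)
    (fun P hP => by
      obtain ⟨hPS, hPa⟩ := Finset.mem_filter.1 hP
      have h1 : eval P.rep e ≠ 0 := by
        have := hreg P hPS
        rw [mul_comm] at this
        exact this.eval_right_ne_zero hPa
      have h2 := hg.2 P hPS
      rw [map_mul] at h2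
      exact (mul_eq_zero.1 h2).resolve_left h1)
  rw [hcount] at hbez
  have hj3 : j ≤ 3 := by omega
  obtain rfl | rfl : j = 0 ∨ j = 3 := by
    by_contra! h
    have : 3 ≤ j := Nat.le_of_mul_le_mul_right hbez (by omega)
    omega
  · have h1 := totalDegree_eq_zero_iff_eq_C.1 ((totalDegree_zero_iff_isHomogeneous _).2 hj)
    have h2 := totalDegree_eq_zero_iff_eq_C.1 ((totalDegree_zero_iff_isHomogeneous _).2 hb)
    have h3 : coeff 0 a ≠ 0 := fun h => ha0 (by rw [h1, h, C_0])
    refine ⟨coeff 0 b / coeff 0 a, ?_⟩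
    rw [h1, h2, smul_eq_C_mul]
    simp only [coeff_C, if_true]
    rw [mul_left_comm, ← C_mul, div_mul_cancel₀ _ h3]
  · exfalso
    have hi0 : i = 0 := by omega
    subst hi0
    have heu := isUnit_of_isHomogeneous_zero hi he0
    obtain ⟨τ, o, hτ1, -, -, ho, hτo⟩ := hτ
    have := class_eq_of_isRelPrime hf hf0 hg.1 hg0 ((isRelPrime_mul_unit_left heu).2 hab) hcard
      (fun P hP => (hreg P hP).1) hg.2 hc ho
    rw [this] at hτo
    exact hτ1 (mul_eq_right.1 hτo.symm)

end PlaneCurve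

end

open MvPolynomial PlaneCurve TernaryForm in
theorem mainTheorem5 (S : Set RealPlane) (hS : IsAdmissible S)
    (f : TernaryPoly) (hf : f.IsHomogeneous 3) (hf0 : f ≠ 0)
    (hfS : ∀ P ∈ S, MvPolynomial.eval P.rep f = 0) :
    formsThrough 3 S = Submodule.span ℝ {f} ∧
    (Squarefree f ∧ (∀ P ∈ S, PlaneCurve.IsRegularRealPoint f P) ∧
      PlaneCurve.RealPointsDense f) ∧
    ∀ f' : TernaryPoly, Irreducible f' → f' ∣ f →
      {P ∈ S | MvPolynomial.eval P.rep f' = 0}.ncard = 3 * f'.totalDegree := by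
  obtain ⟨hcard, f₀, hf₀, hsq, hreg, c, hc, hτ⟩ := hS
  have hfin : S.Finite := Set.finite_of_ncard_ne_zero (by omega)
  lift S to Finset RealPlane using hfin
  rw [Set.ncard_coe_finset] at hcard
  simp only [Finset.mem_coe] at hreg hfS
  have hf₀0 : f₀ ≠ 0 := hsq.ne_zero
  have hall : ∀ g ∈ formsThrough 3 (S : Set RealPlane), ∃ r : ℝ, g = r • f₀ := fun g hg =>
    exists_eq_smul_of_mem_formsThrough hf₀ hf₀0 hcard hreg hc hτ hg
  obtain ⟨r, hr⟩ := hall f ⟨hf, hfS⟩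
  have hr0 : r ≠ 0 := by rintro rfl; exact hf0 (by rw [hr, zero_smul])
  have hfac : f = C r * f₀ := by rw [hr, smul_eq_C_mul]
  have hCr : IsUnit (C r : TernaryPoly) := (isUnit_iff_ne_zero.2 hr0).map C
  have hassoc : Associated f₀ f := by
    rw [hfac]; exact (associated_isUnit_mul_left_iff hCr).2 (Associated.refl _) |>.symm
  have hcount : ∀ (a : TernaryPoly) (d : ℕ), a ∣ f → a.IsHomogeneous d →
      (S.filter fun P => eval P.rep a = 0).card = 3 * d := by
    intro a d ha had
    obtain ⟨b, rfl⟩ := ha.trans hassoc.symm.dvd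
    obtain ⟨i, j, hij, hi, hj⟩ := isHomogeneous_factors hf₀ hf₀0
    obtain rfl := hi.inj_right had (left_ne_zero_of_mul hf₀0)
    exact card_filter_eq hi hj hij hf₀0 hcard hreg hc hτ
  have hregf : ∀ P ∈ S, IsRegularRealPoint f P := by
    intro P hP
    obtain ⟨i, hi⟩ := (hreg P hP).2
    refine ⟨hfS P hP, i, ?_⟩
    rw [hr, Derivation.map_smul, smul_eval]
    exact mul_ne_zero hr0 hi
  have hsqf : Squarefree f := hassoc.squarefree_iff.1 hsq
  refine ⟨le_antisymm (fun g hg => ?_) ?_, ⟨hsqf, hregf, ?_⟩, fun f' hirr hdvd => ?_⟩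
  · obtain ⟨s, hs⟩ := hall g hg
    refine Submodule.mem_span_singleton.2 ⟨s * r⁻¹, ?_⟩
    rw [hs, hr, smul_smul, mul_assoc, inv_mul_cancel₀ hr0, mul_one]
  · rw [Submodule.span_singleton_le_iff_mem]
    exact ⟨hf, hfS⟩
  · refine realPointsDense_of_forall_factor hf hf0 hsqf fun a b d hab had hd => ?_
    have h1 := hcount a d ⟨b, hab⟩ had
    obtain ⟨P, hP⟩ := Finset.card_pos.1 (show 0 < (S.filter fun P => eval P.rep a = 0).card by omega)
    exact ⟨P, hregf P (Finset.mem_filter.1 hP).1, (Finset.mem_filter.1 hP).2⟩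
  · obtain ⟨b, hb⟩ := hdvd
    obtain ⟨i, j, -, hi, -⟩ := isHomogeneous_factors (hb ▸ hf) (hb ▸ hf0)
    rw [hi.totalDegree hirr.ne_zero, ← hcount f' i ⟨b, hb⟩ hi, ← Set.ncard_coe_finset]
    congr 1
    ext P
    simp
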